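/- **Theorem.** Let $1\le r\le n$ and let $f:\Sigma\to\mathbb{H}^{n+1}$ be a smooth, proper immersion of a connected smooth $n$-manifold $\Sigma$ with a smooth unit normal field $\nu$, such that the induced metric is complete. Let $A=-d\nu$ be the shape operator, let $\kappa_1,\dots,\kappa_n$ (the principal curvatures) be its eigenvalues, let $\sigma_k$ be the $k$-th elementary symmetric function, and define $H_k$ by $\binom nk H_k=\sigma_k(\kappa_1,\dots,\kappa_n)$. Let $P_0=I$, $P_k=\sigma_k(\kappa)\,I-AP_{k-1}$, and $L_ku=\operatorname{tr}(P_k\operatorname{Hess}u)$, where $\operatorname{Hess}$ is the Hessian of the induced metric. Assume that 1. $H_r$ is constant on $\Sigma$; 2. $\Sigma$ is $r$-admissible: at every point $(\kappa_1,\dots,\kappa_n)$ lies in the connected component $\Gamma_r$ of $\{\sigma_r>0\}\subset\mathbb{R}^n$ that contains $(1,\dots,1)$; 3. $\Sigma$ is $L_{r-1}$-parabolic: every $C^2$ function $u:\Sigma\to\mathbb{R}$ that is bounded above and satisfies $L_{r-1}u\ge 0$ is constant; 4. $f(\Sigma)$ is contained in a slab, that is, in the closed region between two horospheres with the same asymptotic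 point $q$; 5. the angle function $\Theta=\langle\nu,T\rangle$ does not change sign ($\Theta\ge0$ on $\Sigma$ or $\Theta\le0$ on $\Sigma$), where $\mathbb{H}^{n+1}=\mathbb{R}\times_{e^t}\mathbb{R}^n$ is written as the warped product, with metric $dt^2+e^{2t}\langle\cdot,\cdot\rangle_{\mathbb{R}^n}$, whose slices $\{t\}\times\mathbb{R}^n$ are the horospheres with asymptotic point $q$, and $T=\partial/\partial t$. Then $\Sigma$ is a horosphere: $f$ is injective and $f(\Sigma)$ is a horosphere of $\mathbb{H}^{n+1}$. -/

import Mathlib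

open scoped Manifold ContDiff

noncomputable section

namespace HyperbolicHypersurface

/-! ### The hyperboloid model of hyperbolic space -/

/-- The vector space `ℝ^{n+2}` of Minkowski space, with coordinates `x 0, x 1, …, x (n+1)`. -/
abbrev Minkowski (n : ℕ) : Type := EuclideanSpace ℝ (Fin (n + 2))

/-- The Lorentzian form `⟨x, y⟩ = - x₀ y₀ + ∑_{i ≥ 1} x_i y_i`. -/
def lorentz {n : ℕ} (x y : Minkowski n) : ℝ :=
  -(x 0 * y 0) + ∑ i : Fin (n + 1), x i.succ * y i.succ

/-- Hyperbolic space `ℍ^{n+1}`: the upper sheet of the hyperboloid `⟨x, x⟩ = -1`. -/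
def hyperbolicSpace (n : ℕ) : Set (Minkowski n) :=
  {x | lorentz x x = -1 ∧ 0 < x 0}

/-- The positive null cone. Its rays are the points of the ideal boundary of `ℍ^{n+1}`. -/
def nullCone (n : ℕ) : Set (Minkowski n) :=
  {x | lorentz x x = 0 ∧ 0 < x 0}

/-- The horosphere `{x ∈ ℍ^{n+1} : ⟨x, N⟩ = -c}`, whose asymptotic point is the ray of `N`
(for `N` in the positive null cone and `c > 0`). -/
def horosphere {n : ℕ} (N : Minkowski n) (c : ℝ) : Set (Minkowski n) :=
  {x | x ∈ hyperbolicSpace n ∧ lorentz x N = -c}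

/-- `S` is a horosphere of `ℍ^{n+1}`. -/
def IsHorosphere {n : ℕ} (S : Set (Minkowski n)) : Prop :=
  ∃ N ∈ nullCone n, ∃ c : ℝ, 0 < c ∧ S = horosphere N c

/-- The closed region between the two horospheres `horosphere N a` and `horosphere N b`, which
share the asymptotic point given by `N` (for `0 < a < b`). -/
def slab {n : ℕ} (N : Minkowski n) (a b : ℝ) : Set (Minkowski n) :=
  {x | x ∈ hyperbolicSpace n ∧ a ≤ -lorentz x N ∧ -lorentz x N ≤ b}

/-- The unit vector field `T = ∂/∂t` of the warped product `ℍ^{n+1} = ℝ ×_{e^t} ℝ^n` whose leaves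
`{t} × ℝ^n` are the horospheres with asymptotic point `N`.

Here `e^t = -⟨x, N⟩`, that is, the height is `t = log (-⟨x, N⟩)`, and `T`, its gradient in
`ℍ^{n+1}`, is `x + ⟨x, N⟩⁻¹ N`. Replacing `N` by a positive multiple shifts `t` by a constant and
does not change `T`. -/
def verticalField {n : ℕ} (N x : Minkowski n) : Minkowski n :=
  x + (lorentz x N)⁻¹ • N

/-! ### Local geometry of a parametrized hypersurface

`X` is a local parametrization of the hypersurface, `η` its unit normal and `u` a function, all
three written in the coordinates `x ∈ ℝ^n`. -/

/-- The partial derivative `∂_i F`. -/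
def pd {n : ℕ} {W : Type*} [NormedAddCommGroup W] [NormedSpace ℝ W] (i : Fin n)
    (F : EuclideanSpace ℝ (Fin n) → W) (x : EuclideanSpace ℝ (Fin n)) : W :=
  fderiv ℝ F x (EuclideanSpace.single i 1)

/-- The induced metric `g_ij = ⟨∂_i X, ∂_j X⟩`. -/
def metricMatrix {n : ℕ} (X : EuclideanSpace ℝ (Fin n) → Minkowski n)
    (x : EuclideanSpace ℝ (Fin n)) : Matrix (Fin n) (Fin n) ℝ :=
  Matrix.of fun i j => lorentz (pd i X x) (pd j X x)

/-- The second fundamental form `b_ij = -⟨∂_i η, ∂_j X⟩` with respect to `η`. Since the vectors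
`∂_j X` are tangent to the hyperboloid, the flat derivative may be used in place of the Levi-Civita
connection of `ℍ^{n+1}`. -/
def secondFormMatrix {n : ℕ} (X η : EuclideanSpace ℝ (Fin n) → Minkowski n)
    (x : EuclideanSpace ℝ (Fin n)) : Matrix (Fin n) (Fin n) ℝ :=
  Matrix.of fun i j => -lorentz (pd i η x) (pd j X x)

/-- The matrix `g⁻¹ b` of the shape operator `A = -dη` in the coordinate frame. -/
def shapeMatrix {n : ℕ} (X η : EuclideanSpace ℝ (Fin n) → Minkowski n)
    (x : EuclideanSpace ℝ (Fin n)) : Matrix (Fin n) (Fin n) ℝ :=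
  (metricMatrix X x)⁻¹ * secondFormMatrix X η x

/-- The Christoffel symbols `Γ^k_ij = ½ g^{kl} (∂_i g_jl + ∂_j g_il - ∂_l g_ij)` of the induced
metric. -/
def christoffel {n : ℕ} (X : EuclideanSpace ℝ (Fin n) → Minkowski n)
    (x : EuclideanSpace ℝ (Fin n)) (k i j : Fin n) : ℝ :=
  (1 / 2) * ∑ l, (metricMatrix X x)⁻¹ k l *
    (pd i (fun y => metricMatrix X y j l) x + pd j (fun y => metricMatrix X y i l) x
      - pd l (fun y => metricMatrix X y i j) x)

/-- The Hessian `∂_i ∂_j u - Γ^k_ij ∂_k u` of `u` for the induced metric. -/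
def hessianMatrix {n : ℕ} (X : EuclideanSpace ℝ (Fin n) → Minkowski n)
    (u : EuclideanSpace ℝ (Fin n) → ℝ) (x : EuclideanSpace ℝ (Fin n)) :
    Matrix (Fin n) (Fin n) ℝ :=
  Matrix.of fun i j => pd i (pd j u) x - ∑ k, christoffel X x k i j * pd k u x

/-- The eigenvalues of a matrix, with multiplicity (for a diagonalizable real matrix, as the shape
operator is). -/
def eigenvalues {n : ℕ} (A : Matrix (Fin n) (Fin n) ℝ) : Multiset ℝ :=
  A.charpoly.roots

/-- The Newton transformations `P_0 = I`, `P_k = σ_k I - A P_{k-1}`, where `σ_k` is the `k`-th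
elementary symmetric function of the eigenvalues of `A`. -/
def newton {n : ℕ} (A : Matrix (Fin n) (Fin n) ℝ) : ℕ → Matrix (Fin n) (Fin n) ℝ
  | 0 => 1
  | k + 1 => (eigenvalues A).esymm (k + 1) • (1 : Matrix (Fin n) (Fin n) ℝ) - A * newton A k

/-- `L_k u = tr (P_k (Hess u))`, where `Hess u` is the endomorphism with matrix
`g⁻¹ (∇²u)_ij`. -/
def localL {n : ℕ} (k : ℕ) (X η : EuclideanSpace ℝ (Fin n) → Minkowski n)
    (u : EuclideanSpace ℝ (Fin n) → ℝ) (x : EuclideanSpace ℝ (Fin n)) : ℝ :=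
  (newton (shapeMatrix X η x) k * ((metricMatrix X x)⁻¹ * hessianMatrix X u x)).trace

/-! ### The Gårding cone -/

/-- `Γ_k`: the connected component of `{σ_k > 0} ⊆ ℝ^n` that contains `(1, …, 1)`. -/
def gardingCone (n k : ℕ) : Set (Fin n → ℝ) :=
  connectedComponentIn {κ | 0 < (Finset.univ.val.map κ).esymm k} (fun _ => 1)

/-! ### Immersed oriented hypersurfaces -/

section Hypersurface

variable {n : ℕ} {M : Type*} [TopologicalSpace M] [ChartedSpace (EuclideanSpace ℝ (Fin n)) M]

/-- `f` is a smooth immersion of the `n`-manifold `M` into `ℍ^{n+1}`, and `ν` is a smooth unit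
normal field along `f`, tangent to `ℍ^{n+1}`. -/
structure IsOrientedHypersurface (f ν : M → Minkowski n) : Prop where
  smooth : ContMDiff (𝓡 n) 𝓘(ℝ, Minkowski n) ∞ f
  mem : ∀ p, f p ∈ hyperbolicSpace n
  immersion : ∀ p, Function.Injective (mfderiv (𝓡 n) 𝓘(ℝ, Minkowski n) f p)
  normal_smooth : ContMDiff (𝓡 n) 𝓘(ℝ, Minkowski n) ∞ ν
  normal_unit : ∀ p, lorentz (ν p) (ν p) = 1
  normal_tangent : ∀ p, lorentz (ν p) (f p) = 0
  normal_orthogonal : ∀ p (v : TangentSpace (𝓡 n) p),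
    lorentz (ν p) (mfderiv (𝓡 n) 𝓘(ℝ, Minkowski n) f p v : Minkowski n) = 0

/-- The length of a tangent vector for the metric induced by `f`. -/
def inducedNorm (f : M → Minkowski n) (p : M) (v : TangentSpace (𝓡 n) p) : ℝ :=
  √(lorentz (mfderiv (𝓡 n) 𝓘(ℝ, Minkowski n) f p v : Minkowski n)
    (mfderiv (𝓡 n) 𝓘(ℝ, Minkowski n) f p v : Minkowski n))

/-- The Riemannian distance of the metric induced by `f`: the infimum of the lengths of `C^1`
paths. -/
def inducedEDist (f : M → Minkowski n) (p q : M) : ENNReal :=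
  letI : ∀ x : M, ENorm (TangentSpace (𝓡 n) x) :=
    fun x => ⟨fun v => ENNReal.ofReal (inducedNorm f x v)⟩
  Manifold.riemannianEDist (𝓡 n) p q

/-- The induced metric is complete: its Cauchy sequences converge. -/
def IsCompleteHypersurface (f : M → Minkowski n) : Prop :=
  ∀ s : ℕ → M,
    (∀ ε : ENNReal, 0 < ε → ∃ K, ∀ i ≥ K, ∀ j ≥ K, inducedEDist f (s i) (s j) < ε) →
      ∃ p, Filter.Tendsto s Filter.atTop (nhds p)

/-- A function on `M`, written in the preferred chart around `p`. -/
def inChart {W : Type*} (p : M) (F : M → W) : EuclideanSpace ℝ (Fin n) → W :=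
  F ∘ (chartAt (EuclideanSpace ℝ (Fin n)) p).symm

/-- The principal curvatures at `p` with respect to `ν`: the eigenvalues of the shape operator. -/
def principalCurvatures (f ν : M → Minkowski n) (p : M) : Multiset ℝ :=
  eigenvalues (shapeMatrix (inChart p f) (inChart p ν)
    (chartAt (EuclideanSpace ℝ (Fin n)) p p))

/-- The `k`-mean curvature, `binom(n,k) H_k = σ_k(κ)`. -/
def meanCurvature (k : ℕ) (f ν : M → Minkowski n) (p : M) : ℝ :=
  (principalCurvatures f ν p).esymm k / (n.choose k : ℝ)

/-- `k`-admissibility: at every point the vector of principal curvatures lies in `Γ_k`. (`Γ_k` is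
invariant under permutations, so the ordering of the curvatures does not matter.) -/
def IsAdmissible (k : ℕ) (f ν : M → Minkowski n) : Prop :=
  ∀ p, ∃ κ : Fin n → ℝ,
    Finset.univ.val.map κ = principalCurvatures f ν p ∧ κ ∈ gardingCone n k

/-- The operator `L_k u = tr (P_k (Hess u))` on the hypersurface. -/
def opL (k : ℕ) (f ν : M → Minkowski n) (u : M → ℝ) (p : M) : ℝ :=
  localL k (inChart p f) (inChart p ν) (inChart p u) (chartAt (EuclideanSpace ℝ (Fin n)) p p)

/-- `L_k`-parabolicity: the only bounded above solutions of `L_k u ≥ 0` are the constants. The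
functions `u` are taken of class `C^2`, for which `tr (P_k (Hess u))` makes sense pointwise; as a
hypothesis this is implied by the same property for `C^1` functions and the weak inequality. -/
def IsParabolic (k : ℕ) (f ν : M → Minkowski n) : Prop :=
  ∀ u : M → ℝ, ContMDiff (𝓡 n) 𝓘(ℝ, ℝ) 2 u → BddAbove (Set.range u) →
    (∀ p, 0 ≤ opL k f ν u p) → ∃ c, ∀ p, u p = c

/-- The angle function `Θ = ⟨ν, T⟩` with respect to the foliation by horospheres with asymptotic
point `N`. -/
def angle (N : Minkowski n) (f ν : M → Minkowski n) (p : M) : ℝ :=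
  lorentz (ν p) (verticalField N (f p))

end Hypersurface

end HyperbolicHypersurface

end

noncomputable section

namespace HyperbolicHypersurface

/-! ### Newton and Maclaurin inequalities -/

/-! Let `N` be a null vector on the ray of the asymptotic point. The proof works with two functions
on Σ: the height `ρ = -⟨f, N⟩ = e^t` and `τ = -⟨ν, N⟩`. They satisfy `Θ = τ/ρ` and `|τ| ≤ ρ`. The
slab condition bounds `ρ` between positive constants, so it suffices to show by parabolicity that
`ρ` is constant and then to identify a proper immersion into a single horosphere.

Write `m = r - 1`, `L = L_m`, `H = H_r^{1/r}` and `B = r * binom(n, r)`. The Gauss formula gives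
`Hess ρ = ρ g + τ b`, hence `L ρ = B (ρ H_m + τ H_r)`. Admissibility makes `H_1, …, H_r` positive
(`normEsymm_pos_of_mem_gardingCone`), so Maclaurin's inequalities apply. If `Θ ≥ 0`, then `L ρ ≥ 0`.
If `Θ ≤ 0` and `H ≤ 1`, then `H_m ≥ H^m` and `|τ| ≤ ρ` give `L ρ ≥ B ρ H^m (1 - H) ≥ 0`. In both
cases `ρ` is constant at once.

The case `Θ ≤ 0`, `H > 1` takes two applications of parabolicity. Since `σ_r` is constant, `tr(P_m
∇_k A) = 0` for every `k` (Codazzi and `hasDerivAt_sigma`), which yields a formula for `L τ` without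
derivatives of the curvature. The function `u = Hρ + τ` is then bounded above with `L u ≥ 0` by the
Newton-Maclaurin inequalities, so `u` is constant and `H_m = H^m`. The equality case gives `σ_j =
binom(n, j) H^j` for `j ≤ m`. Differentiating `u` and using `dτ = -dρ ∘ A` gives `A∇ρ = H∇ρ`, so
`∇ρ` is an eigenvector of `P_m`. With `|∇ρ|² = ρ² - τ²` this makes `L(e^{-Kρ})` explicit, and it is
nonnegative for a suitable large `K`. Thus `ρ` is constant (`exists_height_eq`).

Finally, a horosphere projects homeomorphically onto a copy of `ℝ^n`. The projection composed with
`f` is a proper local homeomorphism from a connected space to a simply connected one, hence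
bijective (`injective_and_range_eq_horosphere`). -/

/-- The normalized elementary symmetric function `σ_k / binom(card s, k)`. -/
def normEsymm (s : Multiset ℝ) (k : ℕ) : ℝ := s.esymm k / ((Multiset.card s).choose k : ℝ)

lemma esymm_cons_succ (a : ℝ) (s : Multiset ℝ) (k : ℕ) :
    (a ::ₘ s).esymm (k + 1) = s.esymm (k + 1) + a * s.esymm k := by
  simp [Multiset.esymm, Multiset.powersetCard_cons, Multiset.map_map,
    Multiset.sum_map_mul_left]

lemma esymm_zero' (s : Multiset ℝ) : s.esymm 0 = 1 := by
  simp [Multiset.esymm]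

lemma esymm_eq_zero_of_card_lt {s : Multiset ℝ} {k : ℕ} (h : Multiset.card s < k) :
    s.esymm k = 0 := by
  simp [Multiset.esymm, Multiset.powersetCard_eq_empty _ h]

lemma normEsymm_zero (s : Multiset ℝ) : normEsymm s 0 = 1 := by
  simp [normEsymm, esymm_zero']

lemma esymm_eq_choose_mul_normEsymm {s : Multiset ℝ} {k : ℕ} (hk : k ≤ Multiset.card s) :
    s.esymm k = (Multiset.card s).choose k * normEsymm s k := by
  have : ((Multiset.card s).choose k : ℝ) ≠ 0 := by
    exact_mod_cast (Nat.choose_pos hk).ne'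
  rw [normEsymm]; field_simp

/-- The case `k = card s - 1` of Newton's inequality. -/
lemma newton_top (m : ℕ) : ∀ s : Multiset ℝ, Multiset.card s = m + 2 →
    2 * (m + 2 : ℝ) * (s.esymm (m + 2) * s.esymm m) ≤ (m + 1) * s.esymm (m + 1) ^ 2 := by
  induction m with
  | zero =>
    intro s hs
    obtain ⟨a, b, rfl⟩ := Multiset.card_eq_two.1 hs
    have h : ({a, b} : Multiset ℝ) = a ::ₘ b ::ₘ 0 := rfl
    have e1 : ∀ k, (0 : Multiset ℝ).esymm (k + 1) = 0 := fun k =>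
      esymm_eq_zero_of_card_lt (by simp)
    rw [h]
    simp only [zero_add, esymm_cons_succ, esymm_zero', e1, show (2 : ℕ) = 1 + 1 from rfl]
    have := e1 0
    simp only [zero_add] at this
    norm_num [this]
    nlinarith [sq_nonneg (a - b)]
  | succ m ih =>
    intro s hs
    obtain ⟨a, ha⟩ := Multiset.card_pos_iff_exists_mem.1 (by omega : 0 < Multiset.card s)
    obtain ⟨t, rfl⟩ := Multiset.exists_cons_of_mem ha
    have ht : Multiset.card t = m + 2 := by simpa using hs
    have h0 : t.esymm (m + 2 + 1) = 0 := esymm_eq_zero_of_card_lt (by omega)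
    have := ih t ht
    rw [show m + 1 + 2 = m + 2 + 1 by ring, show m + 1 + 1 = m + 1 + 1 from rfl, esymm_cons_succ,
      esymm_cons_succ, esymm_cons_succ, h0]
    rw [show m + 1 + 1 = m + 2 by ring]
    set A := t.esymm (m + 2)
    set B := t.esymm (m + 1)
    set D := t.esymm m
    push_cast
    have hm : (0 : ℝ) < m + 2 := by positivity
    -- The deficit of the inequality for `a ::ₘ t`, times `m + 2`, is a nonnegative multiple of the
    -- deficit for `t` plus a perfect square. The top term is only `a * A` because `t` has `m + 2`
    -- elements.
    have key : (m + 2 : ℝ) * ((m + 2) * (A + a * B) ^ 2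
        - 2 * (m + 3) * (a * A * (B + a * D)))
        = (m + 3) * a ^ 2 * ((m + 1) * B ^ 2 - 2 * (m + 2) * (A * D))
          + (a * B - (m + 2) * A) ^ 2 := by ring
    have h1 : 0 ≤ (m + 2 : ℝ) * ((m + 2) * (A + a * B) ^ 2
        - 2 * (m + 3) * (a * A * (B + a * D))) := by
      rw [key]
      have : 0 ≤ (m + 1) * B ^ 2 - 2 * (m + 2) * (A * D) := by linarith
      positivity
    have h2 := nonneg_of_mul_nonneg_right h1 hm
    linarith

/-- By Rolle's theorem, the normalized elementary symmetric functions of `n + 1` real numbers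
are, up to degree `n`, those of `n` real numbers. -/
lemma exists_normEsymm_eq {n : ℕ} {s : Multiset ℝ} (hs : Multiset.card s = n + 1) :
    ∃ t : Multiset ℝ, Multiset.card t = n ∧ ∀ k ≤ n, normEsymm t k = normEsymm s k := by
  open Polynomial in
  set p : ℝ[X] := (s.map fun r => X + C r).prod with hp
  have hmonic : p.Monic := monic_multiset_prod_of_monic _ _ fun r _ => monic_X_add_C r
  have hdeg : p.natDegree = n + 1 := by
    rw [hp, natDegree_multiset_prod_of_monic]
    · simp [hs, add_comm]
    · simp only [Multiset.mem_map]
      rintro _ ⟨r, _, rfl⟩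
      exact monic_X_add_C r
  have hroots : Multiset.card p.roots = n + 1 := by
    have : p = ((s.map (fun r => -r)).map fun r => X - C r).prod := by
      rw [hp, Multiset.map_map]; simp
    rw [this, roots_multiset_prod_X_sub_C]; simp [hs]
  set q := derivative p with hq
  have hqdeg : q.natDegree = n := by
    rw [hq, natDegree_derivative, hdeg]; rfl
  -- Rolle: differentiation loses at most one real root, and the degree drops by one, so `q` still
  -- splits over the reals.
  have hqroots : Multiset.card q.roots = q.natDegree := by
    have h1 : Multiset.card p.roots ≤ Multiset.card q.roots + 1 := card_roots_le_derivative p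
    have h2 := q.card_roots'
    omega
  have hlead : q.leadingCoeff = n + 1 := by
    rw [leadingCoeff, hqdeg, hq, coeff_derivative, ← hdeg, hmonic.coeff_natDegree]
    simp
  refine ⟨q.roots.map (fun r => -r), by simp [hqroots, hqdeg], fun k hk => ?_⟩
  have h1 := coeff_eq_esymm_roots_of_card hqroots (k := n - k) (by omega)
  have h2 : q.coeff (n - k) = s.esymm k * ((n - k : ℕ) + 1) := by
    rw [hq, coeff_derivative, hp, Multiset.prod_X_add_C_coeff _ (by omega)]
    congr 2; omega
  rw [h2, hlead, hqdeg, show n - (n - k) = k by omega, mul_assoc, ← Multiset.esymm_neg] at h1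
  have hc : (n.choose k : ℝ) * (n + 1) = (n + 1).choose k * ((n - k : ℕ) + 1) := by
    have := Nat.choose_mul_succ_eq n k
    rw [show n + 1 - k = n - k + 1 by omega] at this
    exact_mod_cast this
  have hp1 : (0 : ℝ) < n.choose k := by exact_mod_cast Nat.choose_pos hk
  have hp2 : (0 : ℝ) < (n + 1).choose k := by exact_mod_cast Nat.choose_pos (by omega)
  rw [normEsymm, normEsymm, hs, Multiset.card_map, hqroots, hqdeg, div_eq_div_iff hp1.ne' hp2.ne']
  have hn : (0 : ℝ) < n + 1 := by positivity
  apply mul_left_cancel₀ hn.ne'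
  linear_combination (-(((n + 1).choose k : ℕ) : ℝ)) * h1 - s.esymm k * hc

/-- Newton's inequality. -/
theorem newton_inequality {k n : ℕ} (hkn : k + 2 ≤ n) : ∀ s : Multiset ℝ, Multiset.card s = n →
    normEsymm s k * normEsymm s (k + 2) ≤ normEsymm s (k + 1) ^ 2 := by
  induction n, hkn using Nat.le_induction with
  | base =>
    intro s hs
    have h := newton_top k s hs
    have e1 := esymm_eq_choose_mul_normEsymm (s := s) (k := k) (by omega)
    have e2 := esymm_eq_choose_mul_normEsymm (s := s) (k := k + 1) (by omega)
    have e3 := esymm_eq_choose_mul_normEsymm (s := s) (k := k + 2) (by omega)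
    rw [hs] at e1 e2 e3
    have c1 : ((k + 2).choose k : ℝ) = (k + 2) * (k + 1) / 2 := by
      rw [Nat.choose_symm_add, Nat.cast_choose_two]; push_cast; ring
    have c2 : ((k + 2).choose (k + 1) : ℝ) = k + 2 := by
      rw [Nat.choose_succ_self_right]; push_cast; ring
    rw [c1] at e1
    rw [c2] at e2
    rw [Nat.choose_self] at e3
    rw [e1, e2, e3] at h
    have : (0 : ℝ) < (k + 1) * (k + 2) ^ 2 := by positivity
    push_cast at h
    nlinarith
  | succ n hn ih =>
    intro s hs
    obtain ⟨t, ht, h⟩ := exists_normEsymm_eq hs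
    -- Passing to the derivative removes one number and keeps the three normalized functions, until
    -- only `k + 2` numbers are left.
    rw [← h k (by omega), ← h (k + 1) (by omega), ← h (k + 2) hn]
    exact ih t ht

/-- Maclaurin's inequality `h_{k+1}^{1/(k+1)} ≤ h_k^{1/k}` in root-free form: Newton's inequality
raised to the power `k + 1`, combined with the previous Maclaurin inequality, after cancelling a
power of `h_{k+1}`. -/
lemma pow_succ_le_of_newton {h : ℕ → ℝ} {r : ℕ} (h0 : h 0 = 1) (hpos : ∀ k ≤ r, 0 < h k)
    (hN : ∀ k, k + 2 ≤ r → h k * h (k + 2) ≤ h (k + 1) ^ 2) :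
    ∀ k, k + 1 ≤ r → h (k + 1) ^ k ≤ h k ^ (k + 1) := by
  intro k
  induction k with
  | zero => intro _; simp [h0]
  | succ k ih =>
    intro hk
    have p0 := hpos k (by omega)
    have p1 := hpos (k + 1) (by omega)
    have p2 := hpos (k + 2) (by omega)
    have h1 := pow_le_pow_left₀ (by positivity) (hN k (by omega)) (k + 1)
    rw [mul_pow, ← pow_mul] at h1
    have h2 : h (k + 1) ^ k * h (k + 2) ^ (k + 1) ≤ h (k + 1) ^ k * h (k + 1) ^ (k + 2) :=
      calc _ ≤ h k ^ (k + 1) * h (k + 2) ^ (k + 1) := by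
            gcongr; exact ih (by omega)
        _ ≤ _ := h1
        _ = _ := by ring
    exact le_of_mul_le_mul_left h2 (by positivity)

lemma pow_le_pow_of_newton {h : ℕ → ℝ} {r : ℕ} (h0 : h 0 = 1) (hpos : ∀ k ≤ r, 0 < h k)
    (hN : ∀ k, k + 2 ≤ r → h k * h (k + 2) ≤ h (k + 1) ^ 2) {k : ℕ} :
    ∀ m, k ≤ m → m ≤ r → h m ^ k ≤ h k ^ m := by
  intro m hkm
  induction m, hkm using Nat.le_induction with
  | base => intro _; exact le_rfl
  | succ m hkm ih =>
    intro hm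
    rcases Nat.eq_zero_or_pos k with rfl | hk
    · simp [h0]
    have p0 := hpos k (by omega)
    have p1 := hpos m (by omega)
    have p2 := hpos (m + 1) (by omega)
    have h1 := ih (by omega)
    have h2 := pow_succ_le_of_newton h0 hpos hN m hm
    have : (h (m + 1) ^ k) ^ m ≤ (h k ^ (m + 1)) ^ m :=
      calc (h (m + 1) ^ k) ^ m = (h (m + 1) ^ m) ^ k := by ring
        _ ≤ (h m ^ (m + 1)) ^ k := by gcongr
        _ = (h m ^ k) ^ (m + 1) := by ring
        _ ≤ (h k ^ m) ^ (m + 1) := by gcongr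
        _ = _ := by ring
    exact le_of_pow_le_pow_left₀ (by omega) (by positivity) this

/-- Equality in one of Maclaurin's inequalities propagates down to degrees one and two. -/
lemma sq_eq_of_pow_eq {h : ℕ → ℝ} {r : ℕ} (h0 : h 0 = 1) (hpos : ∀ k ≤ r, 0 < h k)
    (hN : ∀ k, k + 2 ≤ r → h k * h (k + 2) ≤ h (k + 1) ^ 2) :
    ∀ k, k + 2 ≤ r → h (k + 2) ^ (k + 1) = h (k + 1) ^ (k + 2) → h 1 ^ 2 = h 2 := by
  intro k
  induction k with
  | zero => intro _ he; simpa using he.symm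
  | succ k ih =>
    intro hk he
    -- One inequality is Maclaurin's; for the other, the assumed equality is substituted into a
    -- power of Newton's inequality.
    refine ih (by omega) (le_antisymm (pow_succ_le_of_newton h0 hpos hN _ (by omega)) ?_)
    have p0 := hpos (k + 1) (by omega)
    have p1 := hpos (k + 2) (by omega)
    have h1 := pow_le_pow_left₀ (mul_pos p0 (hpos (k + 3) (by omega))).le (hN (k + 1) (by omega))
      (k + 2)
    rw [mul_pow, show k + 1 + 2 = k + 1 + 1 + 1 by ring] at h1
    rw [show k + 2 = k + 1 + 1 by ring] at *
    rw [show k + 1 + 2 = k + 1 + 1 + 1 by ring] at he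
    rw [he] at h1
    have h2 : h (k + 1 + 1) ^ (k + 1 + 1 + 1) * h (k + 1) ^ (k + 1 + 1)
        ≤ h (k + 1 + 1) ^ (k + 1 + 1 + 1) * h (k + 1 + 1) ^ (k + 1) := by
      calc _ = h (k + 1) ^ (k + 1 + 1) * h (k + 1 + 1) ^ (k + 1 + 1 + 1) := by ring
        _ ≤ _ := h1
        _ = _ := by ring
    exact le_of_mul_le_mul_left h2 (by positivity)

/-- Newton's inequalities give `H_{k+1} ≤ H_1 H_k`. -/
lemma succ_le_one_mul_of_newton {h : ℕ → ℝ} {r : ℕ} (h0 : h 0 = 1) (hpos : ∀ k ≤ r, 0 < h k)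
    (hN : ∀ k, k + 1 ≤ r → h k * h (k + 2) ≤ h (k + 1) ^ 2) :
    ∀ k ≤ r, h (k + 1) ≤ h 1 * h k := by
  intro k
  induction k with
  | zero => intro _; simp [h0]
  | succ k ih =>
    intro hk
    have p0 := hpos k (by omega)
    have p1 := hpos (k + 1) hk
    have h1 := ih (by omega)
    have h2 : h k * h (k + 2) ≤ h k * (h 1 * h (k + 1)) :=
      calc _ ≤ h (k + 1) ^ 2 := hN k (by omega)
        _ = h (k + 1) * h (k + 1) := by ring
        _ ≤ (h 1 * h k) * h (k + 1) := by gcongr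
        _ = _ := by ring
    exact le_of_mul_le_mul_left h2 p0

lemma esymm_one_sq (s : Multiset ℝ) :
    s.esymm 1 ^ 2 = (s.map (· ^ 2)).sum + 2 * s.esymm 2 := by
  induction s using Multiset.induction_on with
  | empty =>
    have h1 : (0 : Multiset ℝ).esymm 1 = 0 := esymm_eq_zero_of_card_lt (by simp)
    have h2 : (0 : Multiset ℝ).esymm 2 = 0 := esymm_eq_zero_of_card_lt (by simp)
    simp [h1, h2]
  | cons a s ih =>
    have h1 := esymm_cons_succ a s 0
    have h2 := esymm_cons_succ a s 1
    rw [esymm_zero'] at h1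
    norm_num at h1 h2
    rw [h1, h2, Multiset.map_cons, Multiset.sum_cons]
    linear_combination ih

lemma esymm_one_eq_sum (s : Multiset ℝ) : s.esymm 1 = s.sum := by
  simp [Multiset.esymm, Multiset.powersetCard_one]

/-- Real numbers with `H_1 ^ 2 = H_2` are all equal. -/
lemma eq_replicate_of_sq_eq {s : Multiset ℝ} (hs : 2 ≤ Multiset.card s)
    (h : normEsymm s 1 ^ 2 = normEsymm s 2) :
    s = Multiset.replicate (Multiset.card s) (normEsymm s 1) := by
  set m := normEsymm s 1
  have e1 : s.sum = Multiset.card s * m := by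
    rw [← esymm_one_eq_sum, esymm_eq_choose_mul_normEsymm (by omega), Nat.choose_one_right]
  have e2 := esymm_eq_choose_mul_normEsymm hs
  rw [Nat.cast_choose_two, ← h] at e2
  -- This identity turns `H_1 ^ 2 = H_2` into the vanishing of the variance about the mean `m`.
  have e3 := esymm_one_sq s
  rw [esymm_one_eq_sum, e1, e2] at e3
  have e4 : (s.map fun x => (x - m) ^ 2).sum = 0 := by
    have : ∀ x : ℝ, (x - m) ^ 2 = x ^ 2 - 2 * m * x + m ^ 2 := fun x => by ring
    have e5 : (s.map fun x => 2 * m * x).sum = 2 * m * (Multiset.card s * m) := by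
      rw [Multiset.sum_map_mul_left, Multiset.map_id', e1]
    simp only [this, Multiset.sum_map_add, Multiset.sum_map_sub,
      Multiset.map_const', Multiset.sum_replicate, nsmul_eq_mul]
    rw [e5]
    linear_combination -e3
  refine Multiset.eq_replicate.2 ⟨rfl, fun x hx => ?_⟩
  have h5 : (x - m) ^ 2 ≤ (s.map fun x => (x - m) ^ 2).sum :=
    Multiset.single_le_sum (by simp only [Multiset.mem_map]; rintro _ ⟨y, _, rfl⟩; positivity) _
      (Multiset.mem_map_of_mem _ hx)
  have h6 : (x - m) ^ 2 = 0 := le_antisymm (h5.trans e4.le) (sq_nonneg _)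
  linarith [pow_eq_zero_iff (two_ne_zero) |>.1 h6]

lemma esymm_replicate (n k : ℕ) (x : ℝ) :
    (Multiset.replicate n x).esymm k = n.choose k * x ^ k := by
  induction n generalizing k with
  | zero => 
    cases k with
    | zero => simp [Multiset.esymm]
    | succ k => rw [esymm_eq_zero_of_card_lt (by simp)]; simp
  | succ n ih =>
    cases k with
    | zero => simp [Multiset.esymm]
    | succ k =>
      rw [Multiset.replicate_succ, esymm_cons_succ, ih, ih, Nat.choose_succ_succ]
      push_cast; ring

/-! ### The Gårding cone -/

lemma continuous_esymm (n k : ℕ) :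
    Continuous fun κ : Fin n → ℝ => (Finset.univ.val.map κ).esymm k := by
  simp only [Finset.esymm_map_val]
  fun_prop

lemma continuous_normEsymm (n k : ℕ) :
    Continuous fun κ : Fin n → ℝ => normEsymm (Finset.univ.val.map κ) k := by
  simp only [normEsymm, Multiset.card_map]
  exact (continuous_esymm n k).div_const _

lemma normEsymm_pos_iff {s : Multiset ℝ} {k : ℕ} (hk : k ≤ Multiset.card s) :
    0 < normEsymm s k ↔ 0 < s.esymm k := by
  have : (0 : ℝ) < (Multiset.card s).choose k := by exact_mod_cast Nat.choose_pos hk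
  rw [normEsymm, div_pos_iff_of_pos_right this]

/-- The set where `H_1, …, H_r` are all positive is open, and it is closed relative to `{σ_r > 0}`:
the Maclaurin inequalities `H_r ^ k ≤ H_k ^ r` pass to the closure, and there `H_r > 0` prevents
`H_k` from vanishing. A connected set in `{σ_r > 0}` that meets it, such as the component of `(1, …,
1)`, lies inside it. -/
theorem normEsymm_pos_of_mem_gardingCone {n r : ℕ} (hr : 1 ≤ r) (hrn : r ≤ n) {κ : Fin n → ℝ}
    (hκ : κ ∈ gardingCone n r) : ∀ k ≤ r, 0 < normEsymm (Finset.univ.val.map κ) k := by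
  set F : ℕ → (Fin n → ℝ) → ℝ := fun k κ => normEsymm (Finset.univ.val.map κ) k with hF
  have hcard : ∀ κ : Fin n → ℝ, Multiset.card (Finset.univ.val.map κ) = n := by simp
  have hcont : ∀ k, Continuous (F k) := continuous_normEsymm n
  set u : Set (Fin n → ℝ) := {κ | ∀ k ∈ Finset.range (r + 1), 0 < F k κ} with hu
  have huo : IsOpen u := by
    simp only [hu, Set.ofPred_forall]
    exact isOpen_biInter_finset fun k _ => isOpen_lt continuous_const (hcont k)
  have hclosed : IsClosed {κ : Fin n → ℝ | ∀ k ∈ Finset.range (r + 1),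
      0 ≤ F k κ ∧ F r κ ^ k ≤ F k κ ^ r} := by
    simp only [Set.ofPred_forall]
    exact isClosed_biInter fun k _ => (isClosed_le continuous_const (hcont k)).inter
      (isClosed_le ((hcont r).pow k) ((hcont k).pow r))
  have hsub : u ⊆ {κ : Fin n → ℝ | ∀ k ∈ Finset.range (r + 1),
      0 ≤ F k κ ∧ F r κ ^ k ≤ F k κ ^ r} := by
    intro κ hκ k hk
    refine ⟨(hκ k hk).le, ?_⟩
    exact pow_le_pow_of_newton (h := fun k => F k κ) (r := r) (normEsymm_zero _)
      (fun k hk => hκ k (by simpa [Nat.lt_succ_iff] using hk))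
      (fun k hk => newton_inequality (hk.trans hrn) _ (hcard κ)) r
      (by simpa [Nat.lt_succ_iff] using hk) le_rfl
  have hone : (fun _ => 1 : Fin n → ℝ) ∈ u := by
    intro k hk
    have hk' : k ≤ n := by
      simp only [Finset.mem_range] at hk; omega
    rw [hF]
    refine (normEsymm_pos_iff (by simpa using hk')).2 ?_
    rw [Multiset.map_const', esymm_replicate]
    have : 0 < n.choose k := Nat.choose_pos hk'
    simpa using this
  have hmem : (fun _ => 1 : Fin n → ℝ) ∈
      {κ : Fin n → ℝ | 0 < (Finset.univ.val.map κ).esymm r} :=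
    (normEsymm_pos_iff (by simpa using hrn)).1 (hone r (by simp))
  have key : gardingCone n r ⊆ u := by
    refine IsPreconnected.subset_of_closure_inter_subset isPreconnected_connectedComponentIn huo
      ⟨_, mem_connectedComponentIn hmem, hone⟩ ?_
    rintro κ ⟨h1, h2⟩ k hk
    have h3 := (closure_minimal hsub hclosed) h1 k hk
    have h6 := connectedComponentIn_subset _ _ h2
    have h4 : 0 < F r κ := (normEsymm_pos_iff (by simpa using hrn)).2 h6
    have h5 : 0 < F k κ ^ r := lt_of_lt_of_le (by positivity) h3.2
    refine lt_of_le_of_ne h3.1 fun h => ?_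
    rw [← h, zero_pow (by omega)] at h5
    exact lt_irrefl _ h5
  intro k hk
  exact key hκ k (by simpa [Nat.lt_succ_iff] using hk)

section

/-! ### Newton transformations -/

open Polynomial in
/-- The matrix `1 + X A` with polynomial entries. -/
def onePlusX {n : ℕ} (A : Matrix (Fin n) (Fin n) ℝ) : Matrix (Fin n) (Fin n) ℝ[X] :=
  1 + (X : ℝ[X]) • A.map C

/-- The coefficients of `det (1 + X A)`. -/
def sigma {n : ℕ} (k : ℕ) (A : Matrix (Fin n) (Fin n) ℝ) : ℝ := (onePlusX A).det.coeff k

/-- The coefficients of the adjugate of `1 + X A`. -/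
def adjCoeff {n : ℕ} (A : Matrix (Fin n) (Fin n) ℝ) (k : ℕ) : Matrix (Fin n) (Fin n) ℝ :=
  (onePlusX A).adjugate.map fun p => p.coeff k

/-- The characteristic polynomial has all its roots real. -/
def RealEigenvalues {n : ℕ} (A : Matrix (Fin n) (Fin n) ℝ) : Prop :=
  Multiset.card (eigenvalues A) = n

variable {n : ℕ} {A : Matrix (Fin n) (Fin n) ℝ}

/-- Both sides are the sum of the principal `k`-minors; Vieta's formula needs all roots to be real.
The right side is polynomial in the entries of `A`, so it can be differentiated without following
individual eigenvalues. -/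
lemma RealEigenvalues.esymm_eq (hA : RealEigenvalues A) (k : ℕ) :
    (eigenvalues A).esymm k = sigma k A := by
  have h := Matrix.coeff_det_one_add_X_smul_eq_sum_minors A k
  rcases le_or_gt k n with hk | hk
  · have h1 := Matrix.charpoly_coeff_eq_sum_minors A k (by simpa using hk)
    have hd : A.charpoly.natDegree = n := by simp
    have h2 := Polynomial.coeff_eq_esymm_roots_of_card (p := A.charpoly) (k := n - k)
      (by rw [hd]; exact hA) (by omega)
    rw [hd, A.charpoly_monic.leadingCoeff, one_mul, show n - (n - k) = k by omega] at h2
    rw [Fintype.card_fin] at h1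
    rw [h1, ← h] at h2
    have h3 : ((-1 : ℝ) ^ k) ≠ 0 := pow_ne_zero _ (by norm_num)
    exact (mul_left_cancel₀ h3 h2).symm
  · rw [esymm_eq_zero_of_card_lt (by rw [hA]; exact hk)]
    rw [sigma, onePlusX, h, Finset.powersetCard_eq_empty.2 (by simpa using hk)]
    simp

lemma adjCoeff_zero_add (A : Matrix (Fin n) (Fin n) ℝ) :
    adjCoeff A 0 = sigma 0 A • (1 : Matrix (Fin n) (Fin n) ℝ) := by
  have h := Matrix.mul_adjugate (onePlusX A)
  ext i j
  have h1 := congrArg (fun p : Polynomial ℝ => p.coeff 0) (congrFun (congrFun h i) j)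
  simp only [onePlusX, add_mul, one_mul, Matrix.smul_mul, Matrix.add_apply, Matrix.smul_apply,
    smul_eq_mul, Polynomial.coeff_add, Polynomial.mul_coeff_zero, Polynomial.coeff_X_zero,
    zero_mul, add_zero] at h1
  simp only [adjCoeff, sigma, onePlusX, Matrix.map_apply, Matrix.smul_apply, smul_eq_mul, h1]
  congr 1
  rcases eq_or_ne i j with rfl | hij <;> simp [*]

/-- This is the coefficient of `X ^ (k + 1)` in `(1 + XA) adj(1 + XA) = det(1 + XA)`. It is the
recursion of the Newton transformations, which are therefore the coefficients of the adjugate. -/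
lemma adjCoeff_succ (A : Matrix (Fin n) (Fin n) ℝ) (k : ℕ) :
    adjCoeff A (k + 1) = sigma (k + 1) A • (1 : Matrix (Fin n) (Fin n) ℝ) - A * adjCoeff A k := by
  have h := Matrix.mul_adjugate (onePlusX A)
  ext i j
  have h1 := congrArg (fun p : Polynomial ℝ => p.coeff (k + 1)) (congrFun (congrFun h i) j)
  have h2 : ((Polynomial.X : Polynomial ℝ) • (A.map Polynomial.C * (onePlusX A).adjugate) i j).coeff
      (k + 1) = (A * adjCoeff A k) i j := by
    simp [Matrix.mul_apply, adjCoeff, Polynomial.coeff_X_mul]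
  rw [show (onePlusX A) * (onePlusX A).adjugate = (onePlusX A).adjugate +
    (Polynomial.X : Polynomial ℝ) • (A.map Polynomial.C * (onePlusX A).adjugate) by
      conv_lhs => enter [1]; rw [onePlusX]
      rw [add_mul, one_mul, Matrix.smul_mul]] at h1
  simp only [Matrix.add_apply, Matrix.smul_apply, Polynomial.coeff_add] at h1
  rw [h2] at h1
  simp only [adjCoeff, sigma, Matrix.map_apply, Matrix.sub_apply, Matrix.smul_apply, smul_eq_mul]
  simp only [adjCoeff] at h1
  have h3 : ((onePlusX A).det * (1 : Matrix (Fin n) (Fin n) (Polynomial ℝ)) i j).coeff (k + 1)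
    = (onePlusX A).det.coeff (k + 1) * (1 : Matrix (Fin n) (Fin n) ℝ) i j := by
    rcases eq_or_ne i j with rfl | hij <;> simp [*]
  rw [smul_eq_mul, h3] at h1
  linarith

lemma sigma_zero (A : Matrix (Fin n) (Fin n) ℝ) : sigma 0 A = 1 := by
  rw [sigma, onePlusX, Matrix.coeff_det_one_add_X_smul_eq_sum_minors]
  simp

lemma RealEigenvalues.newton_eq (hA : RealEigenvalues A) (k : ℕ) :
    newton A k = adjCoeff A k := by
  induction k with
  | zero => rw [adjCoeff_zero_add, sigma_zero, one_smul]; rfl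
  | succ k ih => rw [newton, adjCoeff_succ, ih, hA.esymm_eq]

/-! ### Jacobi's formula and the derivative of `σ_k` -/

/-- Termwise differentiability of a path of polynomials. -/
def HasCoeffDerivAt (p : ℝ → Polynomial ℝ) (p' : Polynomial ℝ) (s : ℝ) : Prop :=
  ∀ k, HasDerivAt (fun t => (p t).coeff k) (p'.coeff k) s

lemma HasCoeffDerivAt.mul {p q : ℝ → Polynomial ℝ} {p' q' : Polynomial ℝ} {s : ℝ}
    (hp : HasCoeffDerivAt p p' s) (hq : HasCoeffDerivAt q q' s) :
    HasCoeffDerivAt (fun t => p t * q t) (p' * q s + p s * q') s := by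
  intro k
  simp only [Polynomial.coeff_mul, Polynomial.coeff_add, ← Finset.sum_add_distrib]
  exact HasDerivAt.fun_sum fun x _ => (hp x.1).mul (hq x.2)

lemma HasCoeffDerivAt.finset_sum {ι : Type*} (u : Finset ι) {p : ι → ℝ → Polynomial ℝ}
    {p' : ι → Polynomial ℝ} {s : ℝ} (hp : ∀ i ∈ u, HasCoeffDerivAt (p i) (p' i) s) :
    HasCoeffDerivAt (fun t => ∑ i ∈ u, p i t) (∑ i ∈ u, p' i) s := by
  intro k
  simp only [Polynomial.finsetSum_coeff]
  exact HasDerivAt.fun_sum fun x hx => hp x hx k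

lemma HasCoeffDerivAt.finset_prod {ι : Type*} [DecidableEq ι] (u : Finset ι)
    {p : ι → ℝ → Polynomial ℝ} {p' : ι → Polynomial ℝ} {s : ℝ}
    (hp : ∀ i ∈ u, HasCoeffDerivAt (p i) (p' i) s) :
    HasCoeffDerivAt (fun t => ∏ i ∈ u, p i t)
      (∑ i ∈ u, p' i * ∏ j ∈ u.erase i, p j s) s := by
  induction u using Finset.induction_on with
  | empty => intro k; simpa using hasDerivAt_const s _
  | insert a u ha ih =>
    have h1 := (hp a (by simp)).mul (ih fun i hi => hp i (by simp [hi]))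
    simp only [Finset.prod_insert ha]
    convert h1 using 1
    rw [Finset.sum_insert ha, Finset.erase_insert ha, Finset.mul_sum]
    congr 1
    refine Finset.sum_congr rfl fun i hi => ?_
    have hia : a ≠ i := fun h => ha (h ▸ hi)
    rw [Finset.erase_insert_of_ne hia, Finset.prod_insert (by simp [ha])]
    ring

/-- By Cramer's rule each diagonal entry is the determinant of `M` with one column replaced by that
of `N`. The Leibniz expansion has the shape that the product rule gives for the derivative of a
determinant. -/
lemma trace_adjugate_mul {R : Type*} [CommRing R] (M N : Matrix (Fin n) (Fin n) R) :
    (M.adjugate * N).trace = ∑ σ : Equiv.Perm (Fin n), (Equiv.Perm.sign σ : ℤ) •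
      ∑ i, N (σ i) i * ∏ j ∈ Finset.univ.erase i, M (σ j) j := by
  have h1 : (M.adjugate * N).trace = ∑ i, (M.updateCol i fun k => N k i).det := by
    rw [Matrix.trace]
    refine Finset.sum_congr rfl fun i _ => ?_
    rw [← Matrix.cramer_apply, Matrix.cramer_eq_adjugate_mulVec]
    rfl
  simp only [h1, Matrix.det_apply, Finset.smul_sum]
  rw [Finset.sum_comm]
  refine Finset.sum_congr rfl fun σ _ => Finset.sum_congr rfl fun i _ => ?_
  rw [← Finset.mul_prod_erase _ _ (Finset.mem_univ i)]
  rw [Matrix.updateCol_self]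
  rw [Finset.prod_congr rfl fun j hj => Matrix.updateCol_ne (Finset.ne_of_mem_erase hj)]
  rfl

lemma hasCoeffDerivAt_det {M : ℝ → Matrix (Fin n) (Fin n) (Polynomial ℝ)}
    {M' : Matrix (Fin n) (Fin n) (Polynomial ℝ)} {s : ℝ}
    (h : ∀ i j, HasCoeffDerivAt (fun t => M t i j) (M' i j) s) :
    HasCoeffDerivAt (fun t => (M t).det) ((M s).adjugate * M').trace s := by
  rw [trace_adjugate_mul]
  simp only [Matrix.det_apply]
  refine HasCoeffDerivAt.finset_sum _ fun σ _ => ?_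
  have h1 := HasCoeffDerivAt.finset_prod Finset.univ (p := fun i t => M t (σ i) i)
    (p' := fun i => M' (σ i) i) (s := s) fun i _ => h (σ i) i
  intro k
  have h2 := (h1 k).const_mul ((Equiv.Perm.sign σ : ℤ) : ℝ)
  have e : ∀ q : Polynomial ℝ, ((Equiv.Perm.sign σ : ℤ) • q).coeff k
      = ((Equiv.Perm.sign σ : ℤ) : ℝ) * q.coeff k := fun q => by
    rw [Polynomial.coeff_smul, zsmul_eq_mul]
  simp only [Units.smul_def, e]
  exact h2

/-- The derivative of `σ_{k+1}` is `tr (P_k dA)`. -/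
theorem hasDerivAt_sigma {B : ℝ → Matrix (Fin n) (Fin n) ℝ} {B' : Matrix (Fin n) (Fin n) ℝ} {s : ℝ}
    (h : ∀ i j, HasDerivAt (fun t => B t i j) (B' i j) s) (k : ℕ) :
    HasDerivAt (fun t => sigma (k + 1) (B t)) (adjCoeff (B s) k * B').trace s := by
  have h1 := hasCoeffDerivAt_det (M := fun t => onePlusX (B t))
    (M' := (Polynomial.X : Polynomial ℝ) • B'.map Polynomial.C) (s := s) ?_ (k + 1)
  · refine h1.congr_deriv ?_
    rw [Matrix.mul_smul, Matrix.trace_smul, smul_eq_mul, Polynomial.coeff_X_mul]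
    simp [Matrix.trace, Matrix.mul_apply, adjCoeff, Polynomial.finsetSum_coeff]
  · intro i j m
    have e : ∀ (D : Matrix (Fin n) (Fin n) ℝ),
        ((Polynomial.X : Polynomial ℝ) • D.map Polynomial.C) i j = Polynomial.X * Polynomial.C (D i j) :=
      fun _ => rfl
    simp only [onePlusX, Matrix.add_apply, e, Polynomial.coeff_add]
    cases m with
    | zero => simpa using hasDerivAt_const s _
    | succ m =>
      simp only [Polynomial.coeff_X_mul]
      refine HasDerivAt.const_add _ ?_
      cases m with
      | zero => simpa using h i j
      | succ m => simpa [Polynomial.coeff_C] using hasDerivAt_const s _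

/-- Jacobi's formula along `t ↦ t A`. -/
lemma trace_adjCoeff_mul_self (A : Matrix (Fin n) (Fin n) ℝ) (k : ℕ) :
    (adjCoeff A k * A).trace = (k + 1) * sigma (k + 1) A := by
  have h1 := hasDerivAt_sigma (B := fun t => t • A) (B' := A) (s := 1)
    (fun i j => by simpa using (hasDerivAt_id (1 : ℝ)).mul_const (A i j)) k
  rw [one_smul] at h1
  -- As a sum of minors of size `k + 1`, `σ_{k+1}` is homogeneous of degree `k + 1`; comparing
  -- derivatives at `t = 1` is Euler's identity.
  have h2 : (fun t : ℝ => sigma (k + 1) (t • A)) = fun t => t ^ (k + 1) * sigma (k + 1) A := by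
    ext t
    simp only [sigma, onePlusX, Matrix.coeff_det_one_add_X_smul_eq_sum_minors]
    rw [Finset.mul_sum]
    refine Finset.sum_congr rfl fun u hu => ?_
    rw [Matrix.submatrix_smul, Pi.smul_apply, Pi.smul_apply, Matrix.det_smul, Fintype.card_coe,
      (Finset.mem_powersetCard.1 hu).2]
  rw [h2] at h1
  have h3 := ((hasDerivAt_pow (k + 1) (1 : ℝ)).mul_const (sigma (k + 1) A))
  simpa using h1.unique h3

lemma commute_newton (A : Matrix (Fin n) (Fin n) ℝ) (k : ℕ) : A * newton A k = newton A k * A := by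
  induction k with
  | zero => simp [newton]
  | succ k ih => rw [newton, mul_sub, sub_mul, mul_assoc A, ← ih]; simp

lemma RealEigenvalues.trace_newton_mul_self (hA : RealEigenvalues A) (k : ℕ) :
    (newton A k * A).trace = (k + 1) * (eigenvalues A).esymm (k + 1) := by
  rw [hA.newton_eq, trace_adjCoeff_mul_self, hA.esymm_eq]

lemma RealEigenvalues.trace_newton (hA : RealEigenvalues A) (k : ℕ) :
    (newton A k).trace = (n - k) * (eigenvalues A).esymm k := by
  cases k with
  | zero => simp [newton, esymm_zero']
  | succ k =>
    rw [newton, Matrix.trace_sub, commute_newton, hA.trace_newton_mul_self, Matrix.trace_smul,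
      Matrix.trace_one]
    simp; ring

/-- Take the trace of `P_{k+1} A`, with `P_{k+1}` replaced by its recursive definition. -/
lemma RealEigenvalues.trace_newton_mul_sq (hA : RealEigenvalues A) (k : ℕ) :
    (newton A k * (A * A)).trace = (eigenvalues A).esymm 1 * (eigenvalues A).esymm (k + 1)
      - (k + 2) * (eigenvalues A).esymm (k + 2) := by
  have h1 := hA.trace_newton_mul_self (k + 1)
  have h0 := hA.trace_newton_mul_self 0
  simp only [newton, one_mul, Nat.cast_zero, zero_add] at h0
  rw [newton, commute_newton, sub_mul, Matrix.trace_sub, Matrix.smul_mul, one_mul,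
    Matrix.trace_smul, h0, mul_assoc, smul_eq_mul] at h1
  push_cast at h1
  linear_combination -h1

/-- The Newton transformation at an eigenvector of an umbilical shape operator. -/
lemma newton_mulVec_of_umbilic {v : Fin n → ℝ} {H : ℝ} (hn : 1 ≤ n) {m : ℕ}
    (hv : A.mulVec v = H • v)
    (hσ : ∀ k ≤ m, (eigenvalues A).esymm k = n.choose k * H ^ k) :
    ∀ k ≤ m, (newton A k).mulVec v = ((n - 1).choose k * H ^ k) • v := by
  intro k
  induction k with
  | zero => intro _; simp [newton]
  | succ k ih =>
    intro hk
    rw [newton, Matrix.sub_mulVec, ← Matrix.mulVec_mulVec, ih (by omega), Matrix.mulVec_smul, hv,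
      Matrix.smul_mulVec, Matrix.one_mulVec, hσ _ hk, smul_smul, ← sub_smul]
    congr 1
    obtain ⟨n, rfl⟩ := Nat.exists_eq_add_of_le' hn
    rw [Nat.choose_succ_succ, Nat.add_sub_cancel]
    push_cast; ring

end

/-! ### Linear algebra of the Lorentzian form -/

section Lorentz

variable {n : ℕ}

lemma lorentz_comm (x y : Minkowski n) : lorentz x y = lorentz y x := by
  simp [lorentz, mul_comm]

lemma lorentz_add_left (x y z : Minkowski n) : lorentz (x + y) z = lorentz x z + lorentz y z := by
  simp only [lorentz, PiLp.add_apply, add_mul, Finset.sum_add_distrib]; ring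

lemma lorentz_smul_left (c : ℝ) (x z : Minkowski n) : lorentz (c • x) z = c * lorentz x z := by
  simp only [lorentz, PiLp.smul_apply, smul_eq_mul, mul_add, Finset.mul_sum, mul_assoc]; ring

/-- The Lorentzian form as a bilinear map. -/
def lorentzBilin (n : ℕ) : Minkowski n →ₗ[ℝ] Minkowski n →ₗ[ℝ] ℝ :=
  LinearMap.mk₂ ℝ lorentz lorentz_add_left lorentz_smul_left
    (fun x y z => by rw [lorentz_comm, lorentz_add_left, lorentz_comm y, lorentz_comm z])
    (fun c x y => by rw [lorentz_comm, lorentz_smul_left, lorentz_comm y]; rfl)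

lemma lorentz_eq (x y : Minkowski n) : lorentz x y = lorentzBilin n x y := rfl

lemma lorentz_add_right (x y z : Minkowski n) : lorentz x (y + z) = lorentz x y + lorentz x z := by
  simp [lorentz_eq]

lemma lorentz_smul_right (c : ℝ) (x z : Minkowski n) : lorentz x (c • z) = c * lorentz x z := by
  simp [lorentz_eq]

lemma lorentz_neg_left (x z : Minkowski n) : lorentz (-x) z = -lorentz x z := by
  simp [lorentz_eq]

lemma lorentz_sub_left (x y z : Minkowski n) : lorentz (x - y) z = lorentz x z - lorentz y z := by
  simp [lorentz_eq]

lemma lorentz_zero_left (z : Minkowski n) : lorentz 0 z = 0 := by simp [lorentz_eq]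

lemma lorentz_zero_right (z : Minkowski n) : lorentz z 0 = 0 := by simp [lorentz_eq]

lemma lorentz_sum_left {ι : Type*} (s : Finset ι) (f : ι → Minkowski n) (z : Minkowski n) :
    lorentz (∑ i ∈ s, f i) z = ∑ i ∈ s, lorentz (f i) z := by
  simp [lorentz_eq]

lemma lorentz_sum_right {ι : Type*} (s : Finset ι) (f : ι → Minkowski n) (z : Minkowski n) :
    lorentz z (∑ i ∈ s, f i) = ∑ i ∈ s, lorentz z (f i) := by
  simp [lorentz_eq]

/-- A vector orthogonal to a timelike unit vector is spacelike. -/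
lemma lorentz_self_pos {X v : Minkowski n} (hX : lorentz X X = -1) (hv : lorentz v X = 0)
    (hv0 : v ≠ 0) : 0 < lorentz v v := by
  have hCS := Finset.sum_mul_sq_le_sq_mul_sq Finset.univ (fun i : Fin (n + 1) => v i.succ)
    (fun i => X i.succ)
  simp only [lorentz] at *
  set a := ∑ i : Fin (n + 1), v i.succ ^ 2 with ha
  set c := ∑ i : Fin (n + 1), X i.succ ^ 2 with hc
  have hX' : ∑ i : Fin (n + 1), X i.succ * X i.succ = c :=
    Finset.sum_congr rfl fun i _ => (sq _).symm
  have hv' : ∑ i : Fin (n + 1), v i.succ * v i.succ = a :=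
    Finset.sum_congr rfl fun i _ => (sq _).symm
  rw [hX'] at hX
  rw [hv']
  have e : ∑ i : Fin (n + 1), v i.succ * X i.succ = v 0 * X 0 := by linarith
  rw [e] at hCS
  have hc0 : 0 ≤ c := Finset.sum_nonneg fun i _ => sq_nonneg _
  have ha0 : 0 ≤ a := Finset.sum_nonneg fun i _ => sq_nonneg _
  -- With `⟨v, X⟩ = 0`, Cauchy-Schwarz on the spatial parts becomes `(1 + c) v₀² ≤ a c`. Together
  -- with `a ≤ v₀²` this would force `a = 0` and then `v = 0`.
  have hX0 : X 0 ^ 2 = 1 + c := by nlinarith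
  have h1 : (1 + c) * v 0 ^ 2 ≤ a * c := by rw [← hX0]; nlinarith
  by_contra hcon
  have h2 : a ≤ v 0 ^ 2 := by nlinarith
  have h3 : a = 0 := by nlinarith
  have h4 : v 0 ^ 2 = 0 := by nlinarith [sq_nonneg (v 0)]
  apply hv0
  ext i
  refine Fin.cases ?_ (fun j => ?_) i
  · simpa using h4
  · have := (Finset.sum_eq_zero_iff_of_nonneg (fun i _ => sq_nonneg _)).1 h3 j (Finset.mem_univ _)
    simpa using this

/-- `X, η, e_1, …, e_n` is a frame of Minkowski space adapted to a hypersurface of `ℍ^{n+1}` with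
position `X`, unit normal `η` and coordinate frame `e`. -/
structure IsAdaptedFrame (X η : Minkowski n) (e : Fin n → Minkowski n) : Prop where
  pos : lorentz X X = -1
  unit : lorentz η η = 1
  normal_pos : lorentz η X = 0
  tangent_pos : ∀ i, lorentz (e i) X = 0
  tangent_normal : ∀ i, lorentz (e i) η = 0
  indep : LinearIndependent ℝ e

namespace IsAdaptedFrame

variable {X η : Minkowski n} {e : Fin n → Minkowski n}

/-- A nonzero `w` orthogonal to `X` is spacelike, so `e_1, …, e_n, η, X, w` would be `n + 3`
independent vectors in a space of dimension `n + 2`. -/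
lemma eq_zero (h : IsAdaptedFrame X η e) {w : Minkowski n} (h1 : lorentz w X = 0)
    (h2 : lorentz w η = 0) (h3 : ∀ i, lorentz w (e i) = 0) : w = 0 := by
  by_contra hw
  have hww := lorentz_self_pos h.pos h1 hw
  let Φ : ((Fin n → ℝ) × ℝ × ℝ × ℝ) →ₗ[ℝ] Minkowski n :=
    (Fintype.linearCombination ℝ e).coprod
      ((LinearMap.toSpanSingleton ℝ _ η).coprod
        ((LinearMap.toSpanSingleton ℝ _ X).coprod (LinearMap.toSpanSingleton ℝ _ w)))
  have hker : LinearMap.ker Φ ≠ ⊥ := by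
    apply LinearMap.ker_ne_bot_of_finrank_lt
    simp
  obtain ⟨⟨a, s, t, u⟩, hm, hne⟩ := Submodule.exists_mem_ne_zero_of_ne_bot hker
  have hΦ : ∑ i, a i • e i + (s • η + (t • X + u • w)) = 0 := by
    simpa [Φ, Fintype.linearCombination_apply] using hm
  have hXη : lorentz X η = 0 := by rw [lorentz_comm, h.normal_pos]
  have p1 := congrArg (fun z => lorentz z X) hΦ
  have p2 := congrArg (fun z => lorentz z η) hΦ
  have p3 := congrArg (fun z => lorentz z w) hΦ
  have h1' : lorentz X w = 0 := by rw [lorentz_comm, h1]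
  have h2' : lorentz η w = 0 := by rw [lorentz_comm, h2]
  have h3' : ∀ i, lorentz (e i) w = 0 := fun i => by rw [lorentz_comm, h3]
  simp only [lorentz_add_left, lorentz_smul_left, lorentz_sum_left, h.tangent_pos,
    h.normal_pos, h.pos, h1, lorentz_zero_left, h.tangent_normal, h.unit, hXη, h2, h1', h2', h3',
    mul_zero, Finset.sum_const_zero, zero_add, add_zero, mul_one] at p1 p2 p3
  have ht : t = 0 := by linarith
  have hs : s = 0 := p2
  have hu : u = 0 := by
    rcases mul_eq_zero.1 p3 with h | h
    · exact h
    · exact absurd h hww.ne'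
  subst ht hs hu
  have ha : a = 0 := by
    have := Fintype.linearIndependent_iff.1 h.indep a (by simpa using hΦ)
    exact funext this
  subst ha
  exact hne rfl

/-- The Gram matrix of the tangent vectors. -/
lemma det_gram_ne_zero (h : IsAdaptedFrame X η e) :
    (Matrix.of fun i j => lorentz (e i) (e j)).det ≠ 0 := by
  intro hdet
  obtain ⟨a, ha, h0⟩ := Matrix.exists_mulVec_eq_zero_iff.2 hdet
  set v := ∑ j, a j • e j with hv
  have h1 : ∀ i, lorentz v (e i) = 0 := fun i => by
    have := congrFun h0 i
    simp only [Matrix.mulVec, dotProduct, Matrix.of_apply, Pi.zero_apply] at this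
    rw [hv, lorentz_sum_left, ← this]
    exact Finset.sum_congr rfl fun j _ => by rw [lorentz_smul_left, lorentz_comm, mul_comm]
  have h2 : v = 0 := h.eq_zero (by simp [hv, lorentz_sum_left, lorentz_smul_left, h.tangent_pos])
    (by simp [hv, lorentz_sum_left, lorentz_smul_left, h.tangent_normal]) h1
  exact ha (funext (Fintype.linearIndependent_iff.1 h.indep a h2))

/-- The expansion of a vector in an adapted frame. -/
lemma eq_sum (h : IsAdaptedFrame X η e) {w : Minkowski n} {c : Fin n → ℝ}
    (hc : ∀ j, ∑ i, c i * lorentz (e i) (e j) = lorentz w (e j)) :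
    w = ∑ i, c i • e i + lorentz w η • η - lorentz w X • X := by
  rw [← sub_eq_zero]
  have hXη : lorentz X η = 0 := by rw [lorentz_comm, h.normal_pos]
  have hte : ∀ i, lorentz η (e i) = 0 := fun i => by rw [lorentz_comm, h.tangent_normal]
  have hXe : ∀ i, lorentz X (e i) = 0 := fun i => by rw [lorentz_comm, h.tangent_pos]
  apply h.eq_zero
  · simp [lorentz_sub_left, lorentz_add_left, lorentz_smul_left, lorentz_sum_left, h.tangent_pos,
      h.normal_pos, h.pos]
  · simp [lorentz_sub_left, lorentz_add_left, lorentz_smul_left, lorentz_sum_left,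
      h.tangent_normal, h.unit, hXη]
  · intro j
    simp [lorentz_sub_left, lorentz_add_left, lorentz_smul_left, lorentz_sum_left, hte, hXe, hc]

end IsAdaptedFrame

end Lorentz

/-! ### Partial derivatives -/

section Calculus

variable {n : ℕ} {W : Type*} [NormedAddCommGroup W] [NormedSpace ℝ W]
  {U : Set (EuclideanSpace ℝ (Fin n))} {x : EuclideanSpace ℝ (Fin n)}

lemma pd_congr {F G : EuclideanSpace ℝ (Fin n) → W} (hU : IsOpen U) (h : ∀ y ∈ U, F y = G y)
    (hx : x ∈ U) (i : Fin n) : pd i F x = pd i G x := by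
  have : F =ᶠ[nhds x] G := Filter.eventuallyEq_of_mem (hU.mem_nhds hx) h
  rw [pd, pd, this.fderiv_eq]

lemma pd_const (c : W) (i : Fin n) : pd i (fun _ => c) x = 0 := by
  simp [pd]

lemma contDiffOn_pd {F : EuclideanSpace ℝ (Fin n) → W} (hU : IsOpen U) (hF : ContDiffOn ℝ ∞ F U)
    (i : Fin n) : ContDiffOn ℝ ∞ (pd i F) U := by
  have := hF.fderiv_of_isOpen hU (m := ∞) (by simp)
  exact this.clm_apply contDiffOn_const

lemma differentiableAt_of_contDiffOn {F : EuclideanSpace ℝ (Fin n) → W} (hU : IsOpen U)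
    (hF : ContDiffOn ℝ ∞ F U) (hx : x ∈ U) : DifferentiableAt ℝ F x :=
  (hF.contDiffAt (hU.mem_nhds hx)).differentiableAt (by simp)

lemma pd_comm {F : EuclideanSpace ℝ (Fin n) → W} (hU : IsOpen U) (hF : ContDiffOn ℝ ∞ F U)
    (hx : x ∈ U) (i j : Fin n) : pd i (pd j F) x = pd j (pd i F) x := by
  have hd : DifferentiableAt ℝ (fderiv ℝ F) x :=
    ((hF.fderiv_of_isOpen hU (m := ∞) (by simp)).contDiffAt (hU.mem_nhds hx)).differentiableAt
      (by simp)
  have key : ∀ i j : Fin n, pd i (pd j F) x = fderiv ℝ (fderiv ℝ F) x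
      (EuclideanSpace.single i 1) (EuclideanSpace.single j 1) := fun i j => by
    change fderiv ℝ (fun y => fderiv ℝ F y (EuclideanSpace.single j 1)) x _ = _
    rw [fderiv_clm_apply hd (differentiableAt_const _)]
    simp
  rw [key, key]
  have hs : IsSymmSndFDerivAt ℝ F x :=
    (hF.contDiffAt (hU.mem_nhds hx)).isSymmSndFDerivAt
      (by simpa using (ENat.LEInfty.out : (2 : WithTop ℕ∞) ≤ ∞))
  exact hs _ _

lemma pd_add {F G : EuclideanSpace ℝ (Fin n) → W} (hF : DifferentiableAt ℝ F x)
    (hG : DifferentiableAt ℝ G x) (i : Fin n) :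
    pd i (fun y => F y + G y) x = pd i F x + pd i G x := by
  simp [pd, fderiv_fun_add hF hG]

lemma pd_const_mul {F : EuclideanSpace ℝ (Fin n) → ℝ} (hF : DifferentiableAt ℝ F x) (c : ℝ)
    (i : Fin n) : pd i (fun y => c * F y) x = c * pd i F x := by
  simp [pd, fderiv_const_mul hF]

lemma pd_mul {F G : EuclideanSpace ℝ (Fin n) → ℝ} (hF : DifferentiableAt ℝ F x)
    (hG : DifferentiableAt ℝ G x) (i : Fin n) :
    pd i (fun y => F y * G y) x = pd i F x * G x + F x * pd i G x := by
  simp [pd, fderiv_fun_mul hF hG]; ring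

lemma pd_sum {ι : Type*} (s : Finset ι) {F : ι → EuclideanSpace ℝ (Fin n) → W}
    (hF : ∀ k ∈ s, DifferentiableAt ℝ (F k) x) (i : Fin n) :
    pd i (fun y => ∑ k ∈ s, F k y) x = ∑ k ∈ s, pd i (F k) x := by
  simp [pd, fderiv_fun_sum hF]

lemma pd_comp {φ : ℝ → ℝ} {φ' : ℝ} {u : EuclideanSpace ℝ (Fin n) → ℝ}
    (hφ : HasDerivAt φ φ' (u x)) (hu : DifferentiableAt ℝ u x) (i : Fin n) :
    pd i (fun y => φ (u y)) x = φ' * pd i u x := by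
  have h := hφ.comp_hasFDerivAt x hu.hasFDerivAt
  change fderiv ℝ (φ ∘ u) x _ = _
  rw [h.fderiv]
  simp [pd]

lemma hasDerivAt_line {F : EuclideanSpace ℝ (Fin n) → ℝ} (hF : DifferentiableAt ℝ F x)
    (i : Fin n) :
    HasDerivAt (fun t : ℝ => F (x + t • EuclideanSpace.single i 1)) (pd i F x) 0 := by
  have h := hF.hasFDerivAt.hasLineDerivAt (EuclideanSpace.single i 1)
  exact h

/-- The Lorentzian form as a continuous bilinear map. -/
def lorentzCLM (n : ℕ) : Minkowski n →L[ℝ] Minkowski n →L[ℝ] ℝ :=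
  LinearMap.toContinuousLinearMap (LinearMap.toContinuousLinearMap.toLinearMap ∘ₗ lorentzBilin n)

lemma lorentzCLM_apply (v w : Minkowski n) : lorentzCLM n v w = lorentz v w := rfl

lemma contDiffOn_lorentz {F G : EuclideanSpace ℝ (Fin n) → Minkowski n}
    (hF : ContDiffOn ℝ ∞ F U) (hG : ContDiffOn ℝ ∞ G U) :
    ContDiffOn ℝ ∞ (fun y => lorentz (F y) (G y)) U := by
  simp only [← lorentzCLM_apply]
  exact (contDiffOn_const.clm_apply hF).clm_apply hG

lemma pd_lorentz {F G : EuclideanSpace ℝ (Fin n) → Minkowski n} (hF : DifferentiableAt ℝ F x)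
    (hG : DifferentiableAt ℝ G x) (i : Fin n) :
    pd i (fun y => lorentz (F y) (G y)) x = lorentz (pd i F x) (G x) + lorentz (F x) (pd i G x) := by
  simp only [← lorentzCLM_apply, pd]
  have h := (lorentzCLM n).hasFDerivAt_of_bilinear hF.hasFDerivAt hG.hasFDerivAt
  rw [h.fderiv]
  simp [add_comm]

end Calculus

/-! ### Local geometry of hypersurfaces -/

/-- `X : U → ℍ^{n+1}` is a smooth immersion with unit normal field `η`. -/
structure IsLocalHypersurface {n : ℕ} (X η : EuclideanSpace ℝ (Fin n) → Minkowski n)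
    (U : Set (EuclideanSpace ℝ (Fin n))) : Prop where
  isOpen : IsOpen U
  smooth : ContDiffOn ℝ ∞ X U
  normal_smooth : ContDiffOn ℝ ∞ η U
  frame : ∀ x ∈ U, IsAdaptedFrame (X x) (η x) (fun i => pd i X x)

namespace IsLocalHypersurface

variable {n : ℕ} {X η : EuclideanSpace ℝ (Fin n) → Minkowski n}
  {U : Set (EuclideanSpace ℝ (Fin n))} {x : EuclideanSpace ℝ (Fin n)}

lemma dX (h : IsLocalHypersurface X η U) (hx : x ∈ U) : DifferentiableAt ℝ X x :=
  differentiableAt_of_contDiffOn h.isOpen h.smooth hx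

lemma dη (h : IsLocalHypersurface X η U) (hx : x ∈ U) : DifferentiableAt ℝ η x :=
  differentiableAt_of_contDiffOn h.isOpen h.normal_smooth hx

lemma dpdX (h : IsLocalHypersurface X η U) (hx : x ∈ U) (i : Fin n) :
    DifferentiableAt ℝ (pd i X) x :=
  differentiableAt_of_contDiffOn h.isOpen (contDiffOn_pd h.isOpen h.smooth i) hx

lemma dpdη (h : IsLocalHypersurface X η U) (hx : x ∈ U) (i : Fin n) :
    DifferentiableAt ℝ (pd i η) x :=
  differentiableAt_of_contDiffOn h.isOpen (contDiffOn_pd h.isOpen h.normal_smooth i) hx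

lemma dpdpdX (h : IsLocalHypersurface X η U) (hx : x ∈ U) (i j : Fin n) :
    DifferentiableAt ℝ (pd i (pd j X)) x :=
  differentiableAt_of_contDiffOn h.isOpen
    (contDiffOn_pd h.isOpen (contDiffOn_pd h.isOpen h.smooth j) i) hx

lemma det_metric_ne_zero (h : IsLocalHypersurface X η U) (hx : x ∈ U) :
    (metricMatrix X x).det ≠ 0 := (h.frame x hx).det_gram_ne_zero

lemma metric_comm (X : EuclideanSpace ℝ (Fin n) → Minkowski n) (x) (i j : Fin n) :
    metricMatrix X x i j = metricMatrix X x j i := lorentz_comm _ _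

lemma metric_mul_shape (h : IsLocalHypersurface X η U) (hx : x ∈ U) :
    metricMatrix X x * shapeMatrix X η x = secondFormMatrix X η x := by
  rw [shapeMatrix, Matrix.mul_nonsing_inv_cancel_left _ _ (h.det_metric_ne_zero hx).isUnit]

lemma lorentz_pd_normal (h : IsLocalHypersurface X η U) (hx : x ∈ U) (i : Fin n) :
    lorentz (pd i η x) (η x) = 0 := by
  have h1 := pd_lorentz (h.dη hx) (h.dη hx) i
  rw [pd_congr h.isOpen (fun y hy => (h.frame y hy).unit) hx, pd_const, lorentz_comm (η x)] at h1
  linarith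

lemma lorentz_pd_normal_pos (h : IsLocalHypersurface X η U) (hx : x ∈ U) (i : Fin n) :
    lorentz (pd i η x) (X x) = 0 := by
  have h1 := pd_lorentz (h.dη hx) (h.dX hx) i
  rw [pd_congr h.isOpen (fun y hy => (h.frame y hy).normal_pos) hx, pd_const,
    lorentz_comm (η x), (h.frame x hx).tangent_normal] at h1
  linarith

lemma lorentz_pd_pd_pos (h : IsLocalHypersurface X η U) (hx : x ∈ U) (i j : Fin n) :
    lorentz (pd i (pd j X) x) (X x) = -metricMatrix X x i j := by
  have h1 := pd_lorentz (h.dpdX hx j) (h.dX hx) i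
  rw [pd_congr h.isOpen (fun y hy => (h.frame y hy).tangent_pos j) hx, pd_const] at h1
  rw [metric_comm, metricMatrix, Matrix.of_apply]
  linarith

lemma lorentz_pd_pd_normal (h : IsLocalHypersurface X η U) (hx : x ∈ U) (i j : Fin n) :
    lorentz (pd i (pd j X) x) (η x) = secondFormMatrix X η x i j := by
  have h1 := pd_lorentz (h.dpdX hx j) (h.dη hx) i
  rw [pd_congr h.isOpen (fun y hy => (h.frame y hy).tangent_normal j) hx, pd_const,
    lorentz_comm (pd j X x)] at h1
  rw [secondFormMatrix, Matrix.of_apply]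
  linarith

lemma secondForm_comm (h : IsLocalHypersurface X η U) (hx : x ∈ U) (i j : Fin n) :
    secondFormMatrix X η x i j = secondFormMatrix X η x j i := by
  rw [← h.lorentz_pd_pd_normal hx, ← h.lorentz_pd_pd_normal hx, pd_comm h.isOpen h.smooth hx]

lemma pd_metric (h : IsLocalHypersurface X η U) (hx : x ∈ U) (k i j : Fin n) :
    pd k (fun y => metricMatrix X y i j) x
      = lorentz (pd k (pd i X) x) (pd j X x) + lorentz (pd k (pd j X) x) (pd i X x) := by
  have h1 := pd_lorentz (h.dpdX hx i) (h.dpdX hx j) k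
  rw [lorentz_comm (pd i X x)] at h1
  exact h1

/-- After expanding the metric derivatives, symmetry of second derivatives cancels all terms but
one, which occurs twice. So the Christoffel symbols are the tangential components of the flat second
derivative of `X`. -/
lemma christoffel_eq (h : IsLocalHypersurface X η U) (hx : x ∈ U) (k i j : Fin n) :
    christoffel X x k i j
      = ∑ l, (metricMatrix X x)⁻¹ k l * lorentz (pd i (pd j X) x) (pd l X x) := by
  rw [christoffel, Finset.mul_sum]
  refine Finset.sum_congr rfl fun l _ => ?_
  rw [h.pd_metric hx, h.pd_metric hx, h.pd_metric hx, pd_comm h.isOpen h.smooth hx j i,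
    pd_comm h.isOpen h.smooth hx l i, pd_comm h.isOpen h.smooth hx l j]
  ring

lemma sum_christoffel_mul_metric (h : IsLocalHypersurface X η U) (hx : x ∈ U) (i j l : Fin n) :
    ∑ m, christoffel X x m i j * metricMatrix X x m l
      = lorentz (pd i (pd j X) x) (pd l X x) := by
  have h1 : (fun m => christoffel X x m i j) = (metricMatrix X x)⁻¹.mulVec
      fun l => lorentz (pd i (pd j X) x) (pd l X x) := by
    ext m; rw [h.christoffel_eq hx]; rfl
  have h2 : (metricMatrix X x).mulVec (fun m => christoffel X x m i j)
      = fun l => lorentz (pd i (pd j X) x) (pd l X x) := by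
    rw [h1, Matrix.mulVec_mulVec, Matrix.mul_nonsing_inv _ (h.det_metric_ne_zero hx).isUnit,
      Matrix.one_mulVec]
  rw [← congrFun h2 l]
  exact Finset.sum_congr rfl fun m _ => by rw [mul_comm, metric_comm]

lemma christoffel_comm (h : IsLocalHypersurface X η U) (hx : x ∈ U) (k i j : Fin n) :
    christoffel X x k i j = christoffel X x k j i := by
  rw [h.christoffel_eq hx, h.christoffel_eq hx, pd_comm h.isOpen h.smooth hx]

/-- The Gauss formula. -/
lemma gauss (h : IsLocalHypersurface X η U) (hx : x ∈ U) (i j : Fin n) :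
    pd i (pd j X) x = ∑ m, christoffel X x m i j • pd m X x
      + secondFormMatrix X η x i j • η x + metricMatrix X x i j • X x := by
  rw [(h.frame x hx).eq_sum (h.sum_christoffel_mul_metric hx i j), h.lorentz_pd_pd_normal hx,
    h.lorentz_pd_pd_pos hx, neg_smul, sub_neg_eq_add]

/-- The Weingarten formula. -/
lemma weingarten (h : IsLocalHypersurface X η U) (hx : x ∈ U) (i : Fin n) :
    pd i η x = -∑ m, shapeMatrix X η x m i • pd m X x := by
  have h1 := (h.frame x hx).eq_sum (w := pd i η x) (c := fun m => -shapeMatrix X η x m i)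
    fun j => by
      have h2 := congrFun (congrFun (h.metric_mul_shape hx) j) i
      rw [h.secondForm_comm hx, Matrix.mul_apply, secondFormMatrix, Matrix.of_apply] at h2
      rw [← neg_eq_iff_eq_neg.2 h2, ← Finset.sum_neg_distrib]
      refine Finset.sum_congr rfl fun m _ => ?_
      rw [metric_comm, metricMatrix, Matrix.of_apply]
      ring
  rw [h1, h.lorentz_pd_normal hx, h.lorentz_pd_normal_pos hx]
  simp

/-- The covariant derivative `∇_k b` of the second fundamental form. -/
def covSecondForm (X η : EuclideanSpace ℝ (Fin n) → Minkowski n) (x : EuclideanSpace ℝ (Fin n))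
    (k : Fin n) : Matrix (Fin n) (Fin n) ℝ :=
  Matrix.of fun i j => pd k (fun y => secondFormMatrix X η y i j) x
    - ∑ m, christoffel X x m k i * secondFormMatrix X η x m j
    - ∑ m, christoffel X x m k j * secondFormMatrix X η x i m

lemma lorentz_pd_normal_pd_pd (h : IsLocalHypersurface X η U) (hx : x ∈ U) (k i j : Fin n) :
    lorentz (pd k η x) (pd i (pd j X) x)
      = -∑ m, christoffel X x m i j * secondFormMatrix X η x k m := by
  rw [h.gauss hx, lorentz_add_right, lorentz_add_right, lorentz_smul_right, lorentz_smul_right,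
    h.lorentz_pd_normal hx, h.lorentz_pd_normal_pos hx, lorentz_sum_right, ← Finset.sum_neg_distrib]
  simp only [mul_zero, add_zero]
  refine Finset.sum_congr rfl fun m _ => ?_
  rw [lorentz_smul_right, secondFormMatrix, Matrix.of_apply]
  ring

/-- Writing `b_ij = ⟨∂_i ∂_j X, η⟩` exposes the symmetric third derivative of `X`, so that Codazzi
reduces to matching Christoffel terms. -/
lemma pd_secondForm (h : IsLocalHypersurface X η U) (hx : x ∈ U) (k i j : Fin n) :
    pd k (fun y => secondFormMatrix X η y i j) x
      = lorentz (pd k (pd i (pd j X)) x) (η x)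
        - ∑ m, christoffel X x m i j * secondFormMatrix X η x k m := by
  rw [pd_congr h.isOpen (fun y hy => (h.lorentz_pd_pd_normal hy i j).symm) hx,
    pd_lorentz (h.dpdpdX hx i j) (h.dη hx), lorentz_comm _ (pd k η x),
    h.lorentz_pd_normal_pd_pd hx]
  ring

lemma covSecondForm_comm (h : IsLocalHypersurface X η U) (hx : x ∈ U) (k i j : Fin n) :
    covSecondForm X η x k i j = covSecondForm X η x k j i := by
  simp only [covSecondForm, Matrix.of_apply]
  rw [pd_congr h.isOpen (fun y hy => h.secondForm_comm hy i j) hx]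
  simp only [h.secondForm_comm hx _ j, h.secondForm_comm hx i]
  ring

/-- The Codazzi equation. -/
lemma codazzi (h : IsLocalHypersurface X η U) (hx : x ∈ U) (k i j : Fin n) :
    covSecondForm X η x k i j = covSecondForm X η x i k j := by
  simp only [covSecondForm, Matrix.of_apply]
  rw [h.pd_secondForm hx, h.pd_secondForm hx,
    pd_comm h.isOpen (contDiffOn_pd h.isOpen h.smooth j) hx k i]
  simp only [h.christoffel_comm hx _ i k]
  ring

/-- Differentiate `⟨∂_j η, ∂_k X⟩ = -b_jk`. Codazzi moves `k` to the position of the differentiation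
index, which prepares the contraction `tr(P_m ∇_k A)`. -/
lemma lorentz_pd_pd_normal_tangent (h : IsLocalHypersurface X η U) (hx : x ∈ U) (i j k : Fin n) :
    lorentz (pd i (pd j η) x - ∑ m, christoffel X x m i j • pd m η x) (pd k X x)
      = -covSecondForm X η x k i j := by
  have h1 := pd_lorentz (h.dpdη hx j) (h.dpdX hx k) i
  rw [h.lorentz_pd_normal_pd_pd hx] at h1
  have h2 : pd i (fun y => lorentz (pd j η y) (pd k X y)) x
      = -pd i (fun y => secondFormMatrix X η y j k) x := by
    simp [secondFormMatrix, pd]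
  rw [h2] at h1
  rw [h.codazzi hx k i j, h.covSecondForm_comm hx i k j, lorentz_sub_left,
    lorentz_sum_left]
  have h3 : ∑ m, lorentz (christoffel X x m i j • pd m η x) (pd k X x)
      = -∑ m, christoffel X x m i j * secondFormMatrix X η x m k := by
    rw [← Finset.sum_neg_distrib]
    refine Finset.sum_congr rfl fun m _ => ?_
    rw [lorentz_smul_left, secondFormMatrix, Matrix.of_apply]; ring
  rw [h3]
  simp only [covSecondForm, Matrix.of_apply]
  linear_combination -h1

/-- The Hessian of the unit normal field. -/
lemma hessian_normal (h : IsLocalHypersurface X η U) (hx : x ∈ U) (i j : Fin n) :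
    pd i (pd j η) x - ∑ m, christoffel X x m i j • pd m η x
      = -∑ l, (∑ k, (metricMatrix X x)⁻¹ l k * covSecondForm X η x k i j) • pd l X x
        - (secondFormMatrix X η x * shapeMatrix X η x) i j • η x
        - secondFormMatrix X η x i j • X x := by
  set w := pd i (pd j η) x - ∑ m, christoffel X x m i j • pd m η x with hw
  have hc : ∀ k, ∑ l, (-∑ k, (metricMatrix X x)⁻¹ l k * covSecondForm X η x k i j)
      * lorentz (pd l X x) (pd k X x) = lorentz w (pd k X x) := fun k => by
    rw [h.lorentz_pd_pd_normal_tangent hx]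
    have h1 : (metricMatrix X x).mulVec ((metricMatrix X x)⁻¹.mulVec
        fun k => covSecondForm X η x k i j) k = covSecondForm X η x k i j := by
      rw [Matrix.mulVec_mulVec, Matrix.mul_nonsing_inv _ (h.det_metric_ne_zero hx).isUnit,
        Matrix.one_mulVec]
    rw [← h1, Matrix.mulVec, dotProduct, ← Finset.sum_neg_distrib]
    refine Finset.sum_congr rfl fun l _ => ?_
    rw [metric_comm, metricMatrix, Matrix.of_apply]
    simp only [Matrix.mulVec, dotProduct]
    rw [neg_mul, mul_comm]
  have hη : lorentz w (η x) = -(secondFormMatrix X η x * shapeMatrix X η x) i j := by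
    have h1 := pd_lorentz (h.dpdη hx j) (h.dη hx) i
    rw [pd_congr h.isOpen (fun y hy => h.lorentz_pd_normal hy j) hx, pd_const] at h1
    have h2 : lorentz (pd j η x) (pd i η x)
        = (secondFormMatrix X η x * shapeMatrix X η x) i j := by
      rw [h.weingarten hx j, lorentz_neg_left, lorentz_sum_left, Matrix.mul_apply,
        ← Finset.sum_neg_distrib]
      refine Finset.sum_congr rfl fun m _ => ?_
      rw [lorentz_smul_left, secondFormMatrix, Matrix.of_apply, lorentz_comm]; ring
    rw [hw, lorentz_sub_left, lorentz_sum_left]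
    simp only [lorentz_smul_left, h.lorentz_pd_normal hx, mul_zero, Finset.sum_const_zero]
    linarith
  have hX : lorentz w (X x) = secondFormMatrix X η x i j := by
    have h1 := pd_lorentz (h.dpdη hx j) (h.dX hx) i
    rw [pd_congr h.isOpen (fun y hy => h.lorentz_pd_normal_pos hy j) hx, pd_const] at h1
    rw [hw, lorentz_sub_left, lorentz_sum_left]
    simp only [lorentz_smul_left, h.lorentz_pd_normal_pos hx, mul_zero, Finset.sum_const_zero]
    rw [h.secondForm_comm hx, secondFormMatrix, Matrix.of_apply]
    linarith
  rw [(h.frame x hx).eq_sum hc, hη, hX]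
  simp only [neg_smul, Finset.sum_neg_distrib]
  abel

end IsLocalHypersurface

/-! ### The operators `L_k` on the coordinate functions -/

lemma differentiableAt_det {E : Type*} [NormedAddCommGroup E] [NormedSpace ℝ E] {n : ℕ}
    {M : E → Matrix (Fin n) (Fin n) ℝ} {x : E}
    (hM : ∀ i j, DifferentiableAt ℝ (fun y => M y i j) x) :
    DifferentiableAt ℝ (fun y => (M y).det) x := by
  simp only [Matrix.det_apply]
  refine DifferentiableAt.fun_sum fun σ _ => ?_
  refine DifferentiableAt.const_smul ?_ _
  exact (HasFDerivAt.finsetProd fun i _ => (hM (σ i) i).hasFDerivAt).differentiableAt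

lemma differentiableAt_inv {E : Type*} [NormedAddCommGroup E] [NormedSpace ℝ E] {n : ℕ}
    {M : E → Matrix (Fin n) (Fin n) ℝ} {x : E} (hx : (M x).det ≠ 0)
    (hM : ∀ i j, DifferentiableAt ℝ (fun y => M y i j) x) (i j : Fin n) :
    DifferentiableAt ℝ (fun y => (M y)⁻¹ i j) x := by
  simp only [Matrix.inv_def, Ring.inverse_eq_inv', Matrix.smul_apply, Matrix.adjugate_apply,
    smul_eq_mul]
  refine ((differentiableAt_det hM).inv hx).mul (differentiableAt_det fun k l => ?_)
  by_cases hk : k = j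
  · subst hk; simp only [Matrix.updateRow_self]; fun_prop
  · simp only [Matrix.updateRow_ne hk]; exact hM k l

/-- The function `-⟨F, N⟩`. -/
def coordFun {n : ℕ} {M : Type*} (N : Minkowski n) (F : M → Minkowski n) (y : M) : ℝ :=
  -lorentz (F y) N

namespace IsLocalHypersurface

variable {n : ℕ} {X η : EuclideanSpace ℝ (Fin n) → Minkowski n}
  {U : Set (EuclideanSpace ℝ (Fin n))} {x : EuclideanSpace ℝ (Fin n)}

lemma differentiableAt_metric (h : IsLocalHypersurface X η U) (hx : x ∈ U) (i j : Fin n) :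
    DifferentiableAt ℝ (fun y => metricMatrix X y i j) x :=
  differentiableAt_of_contDiffOn h.isOpen (contDiffOn_lorentz (contDiffOn_pd h.isOpen h.smooth i)
    (contDiffOn_pd h.isOpen h.smooth j)) hx

lemma differentiableAt_secondForm (h : IsLocalHypersurface X η U) (hx : x ∈ U) (i j : Fin n) :
    DifferentiableAt ℝ (fun y => secondFormMatrix X η y i j) x :=
  (differentiableAt_of_contDiffOn h.isOpen
    (contDiffOn_lorentz (contDiffOn_pd h.isOpen h.normal_smooth i)
      (contDiffOn_pd h.isOpen h.smooth j)) hx).neg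

lemma differentiableAt_shape (h : IsLocalHypersurface X η U) (hx : x ∈ U) (i j : Fin n) :
    DifferentiableAt ℝ (fun y => shapeMatrix X η y i j) x := by
  simp only [shapeMatrix, Matrix.mul_apply]
  exact DifferentiableAt.fun_sum fun k _ =>
    (differentiableAt_inv (h.det_metric_ne_zero hx) (h.differentiableAt_metric hx) i k).mul
      (h.differentiableAt_secondForm hx k j)

/-- The covariant derivative of the second fundamental form in terms of that of the shape
matrix. -/
lemma inv_metric_mul_covSecondForm (h : IsLocalHypersurface X η U) (hx : x ∈ U) (k : Fin n) :
    (metricMatrix X x)⁻¹ * covSecondForm X η x k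
      = Matrix.of (fun i j => pd k (fun y => shapeMatrix X η y i j) x)
        - shapeMatrix X η x * Matrix.of (fun m j => christoffel X x m k j)
        + Matrix.of (fun m j => christoffel X x m k j) * shapeMatrix X η x := by
  set g := metricMatrix X x with hg
  set b := secondFormMatrix X η x with hb
  set A := shapeMatrix X η x with hA
  set G : Matrix (Fin n) (Fin n) ℝ := Matrix.of fun m j => christoffel X x m k j with hG
  set dA : Matrix (Fin n) (Fin n) ℝ := Matrix.of fun i j => pd k (fun y => shapeMatrix X η y i j) x
  have hgA : g * A = b := h.metric_mul_shape hx
  -- Leibniz' rule for `g A = b`, where `∂_k g = Gᵀ g + g G` expresses that the connection is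
  -- metric.
  have hS : covSecondForm X η x k = g * dA - b * G + g * G * A := by
    ext i j
    have h1 : pd k (fun y => secondFormMatrix X η y i j) x
        = ∑ m, (pd k (fun y => metricMatrix X y i m) x * A m j + g i m * dA m j) := by
      rw [pd_congr h.isOpen (fun y hy => (congrFun (congrFun (h.metric_mul_shape hy) i) j).symm) hx]
      simp only [Matrix.mul_apply]
      rw [pd_sum (F := fun m y => metricMatrix X y i m * shapeMatrix X η y m j) _ fun m _ =>
        (h.differentiableAt_metric hx i m).mul (h.differentiableAt_shape hx m j)]
      exact Finset.sum_congr rfl fun m _ =>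
        pd_mul (h.differentiableAt_metric hx i m) (h.differentiableAt_shape hx m j) k
    have h2 : ∀ m, pd k (fun y => metricMatrix X y i m) x = (G.transpose * g + g * G) i m := by
      intro m
      rw [h.pd_metric hx, ← h.sum_christoffel_mul_metric hx, ← h.sum_christoffel_mul_metric hx,
        Matrix.add_apply, Matrix.mul_apply, Matrix.mul_apply]
      congr 1
      exact Finset.sum_congr rfl fun l _ => by rw [mul_comm, metric_comm]; rfl
    have h3 : ∑ m, (G.transpose * g + g * G) i m * A m j
        = (G.transpose * b + g * G * A) i j := by
      rw [← Matrix.mul_apply, add_mul, mul_assoc, hgA]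
    have h4 : ∑ m, christoffel X x m k i * b m j = (G.transpose * b) i j := rfl
    have h5 : ∑ m, christoffel X x m k j * b i m = (b * G) i j :=
      Finset.sum_congr rfl fun l _ => mul_comm _ _
    have h6 : ∑ m, g i m * dA m j = (g * dA) i j := rfl
    simp only [covSecondForm, Matrix.of_apply]
    rw [h4, h5, h1, Finset.sum_add_distrib, h6]
    simp only [h2]
    rw [h3]
    simp only [Matrix.add_apply, Matrix.sub_apply]
    ring
  have hu : IsUnit g.det := (h.det_metric_ne_zero hx).isUnit
  rw [hS, mul_add, mul_sub, ← hgA, mul_assoc g A, mul_assoc g G,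
    Matrix.nonsing_inv_mul_cancel_left _ _ hu, Matrix.nonsing_inv_mul_cancel_left _ _ hu,
    Matrix.nonsing_inv_mul_cancel_left _ _ hu]

/-- `tr (P_m ∇_k A) = 0` when `σ_{m+1}` is constant. -/
lemma trace_newton_mul_covSecondForm (h : IsLocalHypersurface X η U) (hx : x ∈ U)
    (hA : RealEigenvalues (shapeMatrix X η x)) {m : ℕ} {c : ℝ}
    (hc : ∀ y ∈ U, sigma (m + 1) (shapeMatrix X η y) = c) (k : Fin n) :
    (newton (shapeMatrix X η x) m * ((metricMatrix X x)⁻¹ * covSecondForm X η x k)).trace = 0 := by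
  have h1 := hasDerivAt_sigma
    (B := fun t : ℝ => shapeMatrix X η (x + t • EuclideanSpace.single k (1 : ℝ)))
    (B' := Matrix.of fun i j => pd k (fun y => shapeMatrix X η y i j) x) (s := 0)
    (fun i j => hasDerivAt_line (h.differentiableAt_shape hx i j) k) m
  have h2 : (fun t : ℝ => sigma (m + 1)
      (shapeMatrix X η (x + t • EuclideanSpace.single k (1 : ℝ)))) =ᶠ[nhds 0] fun _ => c := by
    have hcont : ContinuousAt (fun t : ℝ => x + t • EuclideanSpace.single k (1 : ℝ)) 0 := by
      fun_prop
    have := hcont.preimage_mem_nhds (t := U) (by simpa using h.isOpen.mem_nhds hx)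
    filter_upwards [this] with t ht using hc _ ht
  have h3 := h1.unique ((hasDerivAt_const (0 : ℝ) c).congr_of_eventuallyEq h2)
  simp only [zero_smul, add_zero] at h3
  rw [← hA.newton_eq] at h3
  -- The Christoffel terms contribute the trace of `P_m` times a commutator with `A`, which vanishes
  -- because `P_m` commutes with `A`.
  have h4 := commute_newton (shapeMatrix X η x) m
  rw [h.inv_metric_mul_covSecondForm hx, mul_add, mul_sub, Matrix.trace_add, Matrix.trace_sub, h3,
    ← mul_assoc, ← mul_assoc, Matrix.trace_mul_comm _ (shapeMatrix X η x), ← mul_assoc, h4]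
  ring

lemma coordFun_contDiffOn {N : Minkowski n} {F : EuclideanSpace ℝ (Fin n) → Minkowski n}
    (hF : ContDiffOn ℝ ∞ F U) : ContDiffOn ℝ ∞ (coordFun N F) U :=
  (contDiffOn_lorentz hF contDiffOn_const).neg

lemma pd_coordFun {N : Minkowski n} {F : EuclideanSpace ℝ (Fin n) → Minkowski n}
    (hF : DifferentiableAt ℝ F x) (i : Fin n) : pd i (coordFun N F) x = -lorentz (pd i F x) N := by
  have h1 := pd_lorentz hF (differentiableAt_const N) i
  rw [pd_const, lorentz_zero_right, add_zero] at h1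
  rw [← h1]
  simp only [pd]
  change (fderiv ℝ (-fun y => lorentz (F y) N) x) _ = _
  rw [fderiv_neg]; rfl

lemma pd_pd_coordFun {N : Minkowski n} {F : EuclideanSpace ℝ (Fin n) → Minkowski n}
    (hU : IsOpen U) (hF : ContDiffOn ℝ ∞ F U) (hx : x ∈ U) (i j : Fin n) :
    pd i (pd j (coordFun N F)) x = -lorentz (pd i (pd j F) x) N := by
  rw [pd_congr hU (G := coordFun N (pd j F)) (fun y hy => pd_coordFun
    (differentiableAt_of_contDiffOn hU hF hy) j) hx,
    pd_coordFun (differentiableAt_of_contDiffOn hU (contDiffOn_pd hU hF j) hx)]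

lemma hessian_coordFun_eq {N : Minkowski n} {F : EuclideanSpace ℝ (Fin n) → Minkowski n}
    (hU : IsOpen U) (hF : ContDiffOn ℝ ∞ F U) (hx : x ∈ U) (i j : Fin n) :
    hessianMatrix X (coordFun N F) x i j
      = -lorentz (pd i (pd j F) x - ∑ m, christoffel X x m i j • pd m F x) N := by
  rw [hessianMatrix, Matrix.of_apply, pd_pd_coordFun hU hF hx, lorentz_sub_left, lorentz_sum_left]
  simp only [pd_coordFun (differentiableAt_of_contDiffOn hU hF hx), lorentz_smul_left, mul_neg,
    Finset.sum_neg_distrib]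
  ring

/-- The Christoffel terms cancel the tangential part of the Gauss formula, leaving its components
along `X` and `η`. -/
lemma hessian_coordFun_position (h : IsLocalHypersurface X η U) (hx : x ∈ U) (N : Minkowski n) :
    hessianMatrix X (coordFun N X) x
      = coordFun N X x • metricMatrix X x + coordFun N η x • secondFormMatrix X η x := by
  ext i j
  rw [hessian_coordFun_eq h.isOpen h.smooth hx, h.gauss hx, add_assoc, add_sub_cancel_left,
    lorentz_add_left, lorentz_smul_left, lorentz_smul_left]
  simp only [coordFun, Matrix.add_apply, Matrix.smul_apply, smul_eq_mul]
  ring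

/-- All derivatives of the curvature are collected in a combination of the `∇_k b`, so tracing
against `P_m` kills them when `σ_{m+1}` is constant. -/
lemma hessian_coordFun_normal (h : IsLocalHypersurface X η U) (hx : x ∈ U) (N : Minkowski n) :
    hessianMatrix X (coordFun N η) x
      = ∑ k, (∑ l, (metricMatrix X x)⁻¹ l k * lorentz (pd l X x) N) • covSecondForm X η x k
        - coordFun N η x • (secondFormMatrix X η x * shapeMatrix X η x)
        - coordFun N X x • secondFormMatrix X η x := by
  ext i j
  rw [hessian_coordFun_eq h.isOpen h.normal_smooth hx, h.hessian_normal hx, lorentz_sub_left,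
    lorentz_sub_left, lorentz_neg_left, lorentz_sum_left, lorentz_smul_left, lorentz_smul_left]
  simp only [coordFun, Matrix.sub_apply, Matrix.smul_apply, smul_eq_mul, Matrix.sum_apply,
    lorentz_smul_left, Finset.sum_mul]
  rw [Finset.sum_comm]
  have : ∀ k l, (metricMatrix X x)⁻¹ l k * covSecondForm X η x k i j * lorentz (pd l X x) N
      = (metricMatrix X x)⁻¹ l k * lorentz (pd l X x) N * covSecondForm X η x k i j :=
    fun k l => by ring
  simp only [this]
  ring

/-- `L_k` of the height function. -/
theorem localL_coordFun_position (h : IsLocalHypersurface X η U) (hx : x ∈ U) (N : Minkowski n)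
    (hA : RealEigenvalues (shapeMatrix X η x)) (k : ℕ) :
    localL k X η (coordFun N X) x
      = coordFun N X x * ((n - k) * (eigenvalues (shapeMatrix X η x)).esymm k)
        + coordFun N η x * ((k + 1) * (eigenvalues (shapeMatrix X η x)).esymm (k + 1)) := by
  have hu := (h.det_metric_ne_zero hx).isUnit
  rw [localL, h.hessian_coordFun_position hx, mul_add, Matrix.mul_smul, Matrix.mul_smul,
    Matrix.nonsing_inv_mul _ hu, ← shapeMatrix, mul_add, Matrix.mul_smul, Matrix.mul_smul, mul_one,
    Matrix.trace_add, Matrix.trace_smul, Matrix.trace_smul, hA.trace_newton,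
    hA.trace_newton_mul_self, smul_eq_mul, smul_eq_mul]

/-- `L_k` of the angle function, when `σ_{k+1}` is constant. -/
theorem localL_coordFun_normal (h : IsLocalHypersurface X η U) (hx : x ∈ U) (N : Minkowski n)
    (hA : RealEigenvalues (shapeMatrix X η x)) {k : ℕ} {c : ℝ}
    (hc : ∀ y ∈ U, sigma (k + 1) (shapeMatrix X η y) = c) :
    localL k X η (coordFun N η) x
      = -(coordFun N η x * ((eigenvalues (shapeMatrix X η x)).esymm 1
          * (eigenvalues (shapeMatrix X η x)).esymm (k + 1)
          - (k + 2) * (eigenvalues (shapeMatrix X η x)).esymm (k + 2)))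
        - coordFun N X x * ((k + 1) * (eigenvalues (shapeMatrix X η x)).esymm (k + 1)) := by
  rw [localL, h.hessian_coordFun_normal hx, mul_sub, mul_sub, Matrix.mul_smul, Matrix.mul_smul,
    mul_sub, mul_sub, Matrix.mul_smul, Matrix.mul_smul,
    ← mul_assoc _ (secondFormMatrix X η x), ← shapeMatrix, Matrix.trace_sub, Matrix.trace_sub, Matrix.trace_smul, Matrix.trace_smul,
    hA.trace_newton_mul_self, hA.trace_newton_mul_sq, Finset.mul_sum, Finset.mul_sum,
    Matrix.trace_sum]
  simp only [Matrix.mul_smul, Matrix.trace_smul, h.trace_newton_mul_covSecondForm hx hA hc,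
    Finset.sum_const_zero, mul_zero, smul_eq_mul]
  ring

lemma hessian_const_mul_add {u v : EuclideanSpace ℝ (Fin n) → ℝ} (hU : IsOpen U)
    (hu : ContDiffOn ℝ ∞ u U) (hv : ContDiffOn ℝ ∞ v U) (hx : x ∈ U) (c : ℝ) :
    hessianMatrix X (fun y => c * u y + v y) x
      = c • hessianMatrix X u x + hessianMatrix X v x := by
  have h1 : ∀ y ∈ U, ∀ j, pd j (fun y => c * u y + v y) y = c * pd j u y + pd j v y :=
    fun y hy j => by
      have du := differentiableAt_of_contDiffOn hU hu hy
      rw [pd_add (du.const_mul c) (differentiableAt_of_contDiffOn hU hv hy), pd_const_mul du]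
  ext i j
  have du := differentiableAt_of_contDiffOn hU (contDiffOn_pd hU hu j) hx
  simp only [hessianMatrix, Matrix.add_apply, Matrix.smul_apply, Matrix.of_apply, h1 x hx]
  rw [pd_congr hU (fun y hy => h1 y hy j) hx, pd_add (du.const_mul c)
    (differentiableAt_of_contDiffOn hU (contDiffOn_pd hU hv j) hx), pd_const_mul du]
  simp only [mul_add, Finset.sum_add_distrib, smul_eq_mul, mul_sub, Finset.mul_sum, mul_left_comm]
  ring

lemma localL_const_mul_add {u v : EuclideanSpace ℝ (Fin n) → ℝ} (hU : IsOpen U)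
    (hu : ContDiffOn ℝ ∞ u U) (hv : ContDiffOn ℝ ∞ v U) (hx : x ∈ U) (c : ℝ) (k : ℕ) :
    localL k X η (fun y => c * u y + v y) x = c * localL k X η u x + localL k X η v x := by
  simp only [localL, hessian_const_mul_add hU hu hv hx, mul_add, Matrix.mul_smul, Matrix.trace_add,
    Matrix.trace_smul, smul_eq_mul]

/-- The chain rule for the Hessian. -/
lemma hessian_comp {φ φ' φ'' : ℝ → ℝ} (hφ : ∀ t, HasDerivAt φ (φ' t) t)
    (hφ' : ∀ t, HasDerivAt φ' (φ'' t) t) {u : EuclideanSpace ℝ (Fin n) → ℝ} (hU : IsOpen U)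
    (hu : ContDiffOn ℝ ∞ u U) (hx : x ∈ U) :
    hessianMatrix X (fun y => φ (u y)) x = φ' (u x) • hessianMatrix X u x
      + φ'' (u x) • Matrix.vecMulVec (fun i => pd i u x) (fun i => pd i u x) := by
  have h1 : ∀ y ∈ U, ∀ j, pd j (fun y => φ (u y)) y = φ' (u y) * pd j u y :=
    fun y hy j => pd_comp (hφ _) (differentiableAt_of_contDiffOn hU hu hy) j
  ext i j
  have du := differentiableAt_of_contDiffOn hU hu hx
  have ddu := differentiableAt_of_contDiffOn hU (contDiffOn_pd hU hu j) hx
  simp only [hessianMatrix, Matrix.add_apply, Matrix.smul_apply, Matrix.of_apply, h1 x hx]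
  rw [pd_congr hU (fun y hy => h1 y hy j) hx,
    pd_mul (F := fun y => φ' (u y)) ((hφ' (u x)).differentiableAt.comp x du) ddu, pd_comp (hφ' _) du]
  simp only [smul_eq_mul, mul_sub, Finset.mul_sum, mul_left_comm, Matrix.vecMulVec_apply]
  ring

/-- The chain rule for `L_k`. -/
lemma localL_comp {φ φ' φ'' : ℝ → ℝ} (hφ : ∀ t, HasDerivAt φ (φ' t) t)
    (hφ' : ∀ t, HasDerivAt φ' (φ'' t) t) {u : EuclideanSpace ℝ (Fin n) → ℝ} (hU : IsOpen U)
    (hu : ContDiffOn ℝ ∞ u U) (hx : x ∈ U) (k : ℕ) :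
    localL k X η (fun y => φ (u y)) x = φ' (u x) * localL k X η u x
      + φ'' (u x) * ((fun i => pd i u x) ⬝ᵥ (newton (shapeMatrix X η x) k).mulVec
          ((metricMatrix X x)⁻¹.mulVec fun i => pd i u x)) := by
  rw [localL, hessian_comp hφ hφ' hU hu hx, mul_add, mul_add, Matrix.trace_add, Matrix.mul_smul,
    Matrix.mul_smul, Matrix.mul_smul, Matrix.mul_smul, Matrix.trace_smul, Matrix.trace_smul,
    ← localL, Matrix.mul_vecMulVec, Matrix.mul_vecMulVec, Matrix.trace_vecMulVec, smul_eq_mul,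
    smul_eq_mul, dotProduct_comm]

/-- The derivative of the angle function is `-dρ ∘ A`. -/
lemma pd_coordFun_normal (h : IsLocalHypersurface X η U) (hx : x ∈ U) (N : Minkowski n)
    (i : Fin n) : pd i (coordFun N η) x
      = -∑ m, shapeMatrix X η x m i * pd m (coordFun N X) x := by
  simp only [pd_coordFun (h.dη hx), pd_coordFun (h.dX hx), h.weingarten hx, lorentz_neg_left,
    lorentz_sum_left, lorentz_smul_left, mul_neg, Finset.sum_neg_distrib]

/-- If `H ρ + ⟨-η, N⟩` is constant then the gradient of `ρ` is an eigenvector of the shape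
operator. -/
lemma shape_mulVec_grad (h : IsLocalHypersurface X η U) (hx : x ∈ U) (N : Minkowski n) {H C : ℝ}
    (hC : ∀ y ∈ U, H * coordFun N X y + coordFun N η y = C) :
    (shapeMatrix X η x).mulVec ((metricMatrix X x)⁻¹.mulVec fun i => pd i (coordFun N X) x)
      = H • (metricMatrix X x)⁻¹.mulVec fun i => pd i (coordFun N X) x := by
  have hu := (h.det_metric_ne_zero hx).isUnit
  have dX := differentiableAt_of_contDiffOn h.isOpen (coordFun_contDiffOn (N := N) h.smooth) hx
  have dη := differentiableAt_of_contDiffOn h.isOpen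
    (coordFun_contDiffOn (N := N) h.normal_smooth) hx
  have h1 : ∀ i, H * pd i (coordFun N X) x = ∑ m, shapeMatrix X η x m i * pd m (coordFun N X) x := by
    intro i
    have h2 := pd_add (dX.const_mul H) dη i
    rw [pd_congr h.isOpen hC hx, pd_const, pd_const_mul dX, h.pd_coordFun_normal hx] at h2
    linarith
  set v : Fin n → ℝ := fun i => pd i (coordFun N X) x with hv
  have h3 : (shapeMatrix X η x).transpose.mulVec v = H • v := funext fun i => (h1 i).symm
  have h4 : (metricMatrix X x)⁻¹.transpose = (metricMatrix X x)⁻¹ := by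
    rw [Matrix.transpose_nonsing_inv]
    congr 1
    ext i j; exact metric_comm _ _ _ _
  have h5 : (secondFormMatrix X η x).transpose = secondFormMatrix X η x := by
    ext i j; exact h.secondForm_comm hx _ _
  -- Differentiating the constant gives `Aᵀ dρ = H dρ`. Since `Aᵀ = b g⁻¹`, applying `g⁻¹` yields
  -- the statement for the gradient.
  rw [shapeMatrix, Matrix.transpose_mul, h4, h5, ← Matrix.mulVec_mulVec] at h3
  rw [shapeMatrix, ← Matrix.mulVec_mulVec, h3, Matrix.mulVec_smul]

/-- `|∇ρ|² = ρ² - ⟨η, N⟩²`. -/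
lemma grad_dot_grad (h : IsLocalHypersurface X η U) (hx : x ∈ U) {N : Minkowski n}
    (hN : lorentz N N = 0) :
    (fun i => pd i (coordFun N X) x) ⬝ᵥ (metricMatrix X x)⁻¹.mulVec
      (fun i => pd i (coordFun N X) x) = coordFun N X x ^ 2 - coordFun N η x ^ 2 := by
  set v : Fin n → ℝ := fun i => pd i (coordFun N X) x with hv
  set c := (metricMatrix X x)⁻¹.mulVec v with hc
  have hv' : ∀ i, v i = -lorentz (pd i X x) N := fun i => pd_coordFun (h.dX hx) i
  have h1 : (metricMatrix X x).mulVec c = v := by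
    rw [hc, Matrix.mulVec_mulVec, Matrix.mul_nonsing_inv _ (h.det_metric_ne_zero hx).isUnit,
      Matrix.one_mulVec]
  -- The tangential part of `-N` is `∇ρ`; pairing the expansion with `-N`, which is null, gives the
  -- formula.
  have h2 := (h.frame x hx).eq_sum (w := -N) (c := c) fun j => by
    rw [lorentz_neg_left, lorentz_comm, ← hv', ← h1]
    exact Finset.sum_congr rfl fun m _ => by rw [mul_comm, lorentz_comm]; rfl
  have h3 := congrArg (fun z => lorentz z (-N)) h2
  simp only [lorentz_sub_left, lorentz_add_left, lorentz_sum_left, lorentz_smul_left,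
    lorentz_neg_left] at h3
  have h4 : ∀ z : Minkowski n, lorentz z (-N) = -lorentz z N := fun z => by
    rw [lorentz_comm, lorentz_neg_left, lorentz_comm]
  have h6 : ∀ i, lorentz (pd i X x) N = -v i := fun i => by rw [hv']; ring
  simp only [h4, h6, hN, lorentz_comm N (η x), lorentz_comm N (X x), neg_neg, neg_zero] at h3
  have h5 : v ⬝ᵥ c = ∑ i, c i * v i := dotProduct_comm _ _
  rw [h5]
  simp only [coordFun]
  linarith

end IsLocalHypersurface

/-! ### From the hypersurface to local parametrizations -/

section Reparametrization

variable {n : ℕ} {X η X' η' : EuclideanSpace ℝ (Fin n) → Minkowski n}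
  {ψ : EuclideanSpace ℝ (Fin n) → EuclideanSpace ℝ (Fin n)} {x : EuclideanSpace ℝ (Fin n)}

/-- The Jacobian matrix. -/
def jacobian (ψ : EuclideanSpace ℝ (Fin n) → EuclideanSpace ℝ (Fin n))
    (x : EuclideanSpace ℝ (Fin n)) : Matrix (Fin n) (Fin n) ℝ :=
  Matrix.of fun k i => pd i ψ x k

lemma pd_comp_eq_sum {W : Type*} [NormedAddCommGroup W] [NormedSpace ℝ W]
    {F F' : EuclideanSpace ℝ (Fin n) → W} (hψ : DifferentiableAt ℝ ψ x)
    (hF : DifferentiableAt ℝ F (ψ x)) (he : F' =ᶠ[nhds x] F ∘ ψ) (i : Fin n) :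
    pd i F' x = ∑ k, jacobian ψ x k i • pd k F (ψ x) := by
  have h1 : ∀ v : EuclideanSpace ℝ (Fin n), v = ∑ k, v k • EuclideanSpace.single k (1 : ℝ) := by
    intro v
    ext j
    simp [Finset.sum_apply, Pi.single_apply]
  rw [pd, he.fderiv_eq, fderiv_comp x hF hψ, ContinuousLinearMap.comp_apply]
  conv_lhs => rw [h1 (fderiv ℝ ψ x _)]
  rw [map_sum]
  simp only [map_smul]
  rfl

lemma gram_eq {E E' : Fin n → Minkowski n} {G G' : Fin n → Minkowski n}
    {J : Matrix (Fin n) (Fin n) ℝ} (hE : ∀ i, E' i = ∑ k, J k i • E k)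
    (hG : ∀ i, G' i = ∑ k, J k i • G k) :
    (Matrix.of fun i j => lorentz (E' i) (G' j))
      = J.transpose * (Matrix.of fun i j => lorentz (E i) (G j)) * J := by
  ext i j
  simp only [hE, hG, lorentz_sum_left, lorentz_sum_right, lorentz_smul_left, lorentz_smul_right,
    Matrix.mul_apply, Matrix.of_apply, Matrix.transpose_apply, Finset.sum_mul, Finset.mul_sum]
  exact Finset.sum_congr rfl fun k _ => Finset.sum_congr rfl fun l _ => by ring

/-- The principal curvatures do not depend on the parametrization. -/
lemma eigenvalues_shape_comp (hψ : DifferentiableAt ℝ ψ x)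
    (hX : DifferentiableAt ℝ X (ψ x)) (hη : DifferentiableAt ℝ η (ψ x))
    (heX : X' =ᶠ[nhds x] X ∘ ψ) (heη : η' =ᶠ[nhds x] η ∘ ψ)
    (hg : (metricMatrix X' x).det ≠ 0) :
    eigenvalues (shapeMatrix X' η' x) = eigenvalues (shapeMatrix X η (ψ x)) := by
  set J := jacobian ψ x
  have h1 := pd_comp_eq_sum hψ hX heX
  have h2 := pd_comp_eq_sum hψ hη heη
  have e1 : metricMatrix X' x = J.transpose * metricMatrix X (ψ x) * J := gram_eq h1 h1
  have e2 : secondFormMatrix X' η' x = J.transpose * secondFormMatrix X η (ψ x) * J := by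
    have h3 : ∀ (Y ζ : EuclideanSpace ℝ (Fin n) → Minkowski n) (y),
        secondFormMatrix Y ζ y = -Matrix.of fun i j => lorentz (pd i ζ y) (pd j Y y) :=
      fun _ _ _ => rfl
    rw [h3, h3, gram_eq h2 h1, mul_neg, neg_mul]
  have hJ : IsUnit J.det := by
    rw [isUnit_iff_ne_zero]
    intro h0
    rw [e1, Matrix.det_mul, h0, mul_zero] at hg
    exact hg rfl
  have hJ' : IsUnit J.transpose.det := by rwa [Matrix.det_transpose]
  rw [eigenvalues, eigenvalues, shapeMatrix, shapeMatrix, e1, e2, Matrix.mul_inv_rev,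
    Matrix.mul_inv_rev, mul_assoc, mul_assoc, mul_assoc, Matrix.nonsing_inv_mul_cancel_left _ _ hJ',
    Matrix.charpoly_mul_comm, mul_assoc, Matrix.mul_nonsing_inv_cancel_right _ _ hJ]

end Reparametrization

lemma contMDiff_coordFun {n : ℕ} {M : Type*} [TopologicalSpace M]
    [ChartedSpace (EuclideanSpace ℝ (Fin n)) M] {N : Minkowski n} {F : M → Minkowski n}
    (hF : ContMDiff (𝓡 n) 𝓘(ℝ, Minkowski n) ∞ F) :
    ContMDiff (𝓡 n) 𝓘(ℝ, ℝ) ∞ (coordFun N F) := by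
  have h1 : ContDiff ℝ ∞ fun v : Minkowski n => -lorentz v N := by
    simp only [← lorentzCLM_apply]
    exact ((lorentzCLM n).contDiff.clm_apply contDiff_const).neg
  exact h1.contMDiff.comp hF

/-! ### Chart computations transferred to the manifold -/

section Manifold

variable {n : ℕ} {M : Type*} [TopologicalSpace M] [ChartedSpace (EuclideanSpace ℝ (Fin n)) M]
  [IsManifold (𝓡 n) ∞ M] {f ν : M → Minkowski n}

lemma contDiffOn_inChart {W : Type*} [NormedAddCommGroup W] [NormedSpace ℝ W] {F : M → W}
    (hF : ContMDiff (𝓡 n) 𝓘(ℝ, W) ∞ F) (p : M) :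
    ContDiffOn ℝ ∞ (inChart p F) (chartAt (EuclideanSpace ℝ (Fin n)) p).target := by
  rw [← contMDiffOn_iff_contDiffOn]
  exact hF.comp_contMDiffOn (contMDiffOn_chart_symm (I := 𝓡 n))

lemma fderiv_inChart {W : Type*} [NormedAddCommGroup W] [NormedSpace ℝ W] {F : M → W}
    (hF : ContMDiff (𝓡 n) 𝓘(ℝ, W) ∞ F) (p : M) {x : EuclideanSpace ℝ (Fin n)}
    (hx : x ∈ (chartAt (EuclideanSpace ℝ (Fin n)) p).target) :
    ∃ L : EuclideanSpace ℝ (Fin n) →L[ℝ]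
      TangentSpace (𝓡 n) ((chartAt (EuclideanSpace ℝ (Fin n)) p).symm x),
      Function.Injective L ∧ ∀ v, fderiv ℝ (inChart p F) x v
        = (mfderiv (𝓡 n) 𝓘(ℝ, W) F ((chartAt (EuclideanSpace ℝ (Fin n)) p).symm x) (L v) : W) := by
  have hc := (mdifferentiable_chart (I := 𝓡 n) p).symm
  have hxs : x ∈ (chartAt (EuclideanSpace ℝ (Fin n)) p).symm.source := hx
  refine ⟨mfderiv (𝓡 n) (𝓡 n) (chartAt (EuclideanSpace ℝ (Fin n)) p).symm x,
    hc.mfderiv_injective hxs, fun v => ?_⟩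
  rw [← mfderiv_eq_fderiv, inChart, mfderiv_comp x
    (hF.mdifferentiableAt (by simp)) (hc.mdifferentiableAt hxs)]
  rfl

lemma IsOrientedHypersurface.isLocalHypersurface (hf : IsOrientedHypersurface f ν) (p : M) :
    IsLocalHypersurface (inChart p f) (inChart p ν)
      (chartAt (EuclideanSpace ℝ (Fin n)) p).target := by
  have hU := (chartAt (EuclideanSpace ℝ (Fin n)) p).open_target
  have hX := contDiffOn_inChart hf.smooth p
  refine ⟨hU, hX, contDiffOn_inChart hf.normal_smooth p, fun x hx => ?_⟩
  obtain ⟨L, hL, hLv⟩ := fderiv_inChart hf.smooth p hx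
  refine ⟨(hf.mem _).1, hf.normal_unit _, hf.normal_tangent _, fun i => ?_, fun i => ?_, ?_⟩
  · have dX := differentiableAt_of_contDiffOn hU hX hx
    have h1 := pd_lorentz dX dX i
    rw [pd_congr hU (F := fun y => lorentz (inChart p f y) (inChart p f y))
      (G := fun _ => -1) (fun y _ => (hf.mem _).1) hx, pd_const,
      lorentz_comm (inChart p f x)] at h1
    linarith
  · rw [lorentz_comm, pd, hLv]
    exact hf.normal_orthogonal _ _
  · have hinj : Function.Injective (fderiv ℝ (inChart p f) x) := by
      intro v w hvw
      rw [hLv, hLv] at hvw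
      exact hL (hf.immersion _ hvw)
    have h2 : LinearIndependent ℝ fun i : Fin n => EuclideanSpace.single i (1 : ℝ) := by
      have e : (fun i : Fin n => EuclideanSpace.single i (1 : ℝ))
          = ⇑(EuclideanSpace.basisFun (Fin n) ℝ) := by
        ext i; simp
      rw [e]
      exact (EuclideanSpace.basisFun (Fin n) ℝ).orthonormal.linearIndependent
    exact h2.map' (fderiv ℝ (inChart p f) x).toLinearMap (LinearMap.ker_eq_bot.2 hinj)

/-- The principal curvatures may be computed in any chart. -/
lemma IsOrientedHypersurface.eigenvalues_eq (hf : IsOrientedHypersurface f ν) (p : M)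
    {y : EuclideanSpace ℝ (Fin n)} (hy : y ∈ (chartAt (EuclideanSpace ℝ (Fin n)) p).target) :
    eigenvalues (shapeMatrix (inChart p f) (inChart p ν) y)
      = principalCurvatures f ν ((chartAt (EuclideanSpace ℝ (Fin n)) p).symm y) := by
  set e := chartAt (EuclideanSpace ℝ (Fin n)) p with he
  set q := e.symm y with hq
  set e' := chartAt (EuclideanSpace ℝ (Fin n)) q with he'
  have hqs : q ∈ e.source := e.map_target hy
  have hq' : e' q ∈ e'.target := mem_chart_target _ q
  have hqq : e'.symm (e' q) = q := e'.left_inv (mem_chart_source _ q)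
  have hψx : (e ∘ e'.symm) (e' q) = y := by
    rw [Function.comp_apply, hqq, hq, e.right_inv hy]
  have hψ : DifferentiableAt ℝ (e ∘ e'.symm) (e' q) := by
    rw [← mdifferentiableAt_iff_differentiableAt]
    refine MDifferentiableAt.comp (I' := 𝓡 n) _ ?_
      ((mdifferentiable_chart (I := 𝓡 n) q).symm.mdifferentiableAt hq')
    rw [hqq]
    exact (mdifferentiable_chart (I := 𝓡 n) p).mdifferentiableAt hqs
  have hev : ∀ {W : Type} (F : M → W), inChart q F =ᶠ[nhds (e' q)] inChart p F ∘ (e ∘ e'.symm) := by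
    intro W F
    have h1 : ∀ᶠ z in nhds (e' q), e'.symm z ∈ e.source := by
      refine (e'.continuousAt_symm hq').preimage_mem_nhds (e.open_source.mem_nhds ?_)
      rwa [hqq]
    filter_upwards [h1] with z hz
    simp only [inChart, Function.comp_apply]
    rw [← he, e.left_inv hz]
  have hloc := hf.isLocalHypersurface p
  have h := eigenvalues_shape_comp (X := inChart p f) (η := inChart p ν) hψ
    (by rw [hψx]; exact hloc.dX hy) (by rw [hψx]; exact hloc.dη hy) (hev f) (hev ν)
    ((hf.isLocalHypersurface q).det_metric_ne_zero hq')
  rw [hψx] at h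
  exact h.symm

/-- The hypotheses on the `r`-mean curvature, in terms of elementary symmetric functions. -/
structure HasConstantSigma (r : ℕ) (c : ℝ) (f ν : M → Minkowski n) : Prop where
  hyp : IsOrientedHypersurface f ν
  card : ∀ p, Multiset.card (principalCurvatures f ν p) = n
  esymm : ∀ p, (principalCurvatures f ν p).esymm r = c

namespace HasConstantSigma

variable {r : ℕ} {c : ℝ} {N : Minkowski n}

lemma realEigenvalues (h : HasConstantSigma r c f ν) (p : M) {y : EuclideanSpace ℝ (Fin n)}
    (hy : y ∈ (chartAt (EuclideanSpace ℝ (Fin n)) p).target) :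
    RealEigenvalues (shapeMatrix (inChart p f) (inChart p ν) y) := by
  rw [RealEigenvalues, h.hyp.eigenvalues_eq p hy]; exact h.card _

/-- Differentiating `σ_r` needs its constancy throughout one chart, whereas the principal curvatures
at each point are defined in that point's own preferred chart; `eigenvalues_eq` bridges the two. -/
lemma sigma_eq (h : HasConstantSigma r c f ν) (p : M) {y : EuclideanSpace ℝ (Fin n)}
    (hy : y ∈ (chartAt (EuclideanSpace ℝ (Fin n)) p).target) :
    sigma r (shapeMatrix (inChart p f) (inChart p ν) y) = c := by
  rw [← (h.realEigenvalues p hy).esymm_eq, h.hyp.eigenvalues_eq p hy, h.esymm]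

lemma opL_height (h : HasConstantSigma r c f ν) (k : ℕ) (p : M) :
    opL k f ν (coordFun N f) p
      = coordFun N f p * ((n - k) * (principalCurvatures f ν p).esymm k)
        + coordFun N ν p * ((k + 1) * (principalCurvatures f ν p).esymm (k + 1)) := by
  have hp := mem_chart_target (EuclideanSpace ℝ (Fin n)) p
  have := (h.hyp.isLocalHypersurface p).localL_coordFun_position hp N (h.realEigenvalues p hp) k
  have e := (chartAt (EuclideanSpace ℝ (Fin n)) p).left_inv (mem_chart_source _ p)
  simp only [coordFun, inChart, Function.comp_apply, e] at this
  exact this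

lemma opL_height_add_angle {k : ℕ} (h : HasConstantSigma (k + 1) c f ν) (H : ℝ) (p : M) :
    opL k f ν (fun q => H * coordFun N f q + coordFun N ν q) p
      = H * (coordFun N f p * ((n - k) * (principalCurvatures f ν p).esymm k)
          + coordFun N ν p * ((k + 1) * (principalCurvatures f ν p).esymm (k + 1)))
        - coordFun N ν p * ((principalCurvatures f ν p).esymm 1
          * (principalCurvatures f ν p).esymm (k + 1)
          - (k + 2) * (principalCurvatures f ν p).esymm (k + 2))
        - coordFun N f p * ((k + 1) * (principalCurvatures f ν p).esymm (k + 1)) := by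
  have hp := mem_chart_target (EuclideanSpace ℝ (Fin n)) p
  have hloc := h.hyp.isLocalHypersurface p
  have h1 := hloc.localL_coordFun_position hp N (h.realEigenvalues p hp) k
  have h2 := hloc.localL_coordFun_normal hp N (h.realEigenvalues p hp)
    fun y hy => h.sigma_eq p hy
  have h3 := IsLocalHypersurface.localL_const_mul_add (X := inChart p f) (η := inChart p ν)
    hloc.isOpen (IsLocalHypersurface.coordFun_contDiffOn (N := N) hloc.smooth)
    (IsLocalHypersurface.coordFun_contDiffOn (N := N) hloc.normal_smooth) hp H k
  rw [h1, h2] at h3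
  have e := (chartAt (EuclideanSpace ℝ (Fin n)) p).left_inv (mem_chart_source _ p)
  refine Eq.trans h3 ?_
  simp only [coordFun, inChart, Function.comp_apply, e]
  rw [show eigenvalues (shapeMatrix (f ∘ (chartAt (EuclideanSpace ℝ (Fin n)) p).symm)
    (ν ∘ (chartAt (EuclideanSpace ℝ (Fin n)) p).symm) (chartAt (EuclideanSpace ℝ (Fin n)) p p))
    = principalCurvatures f ν p from rfl]
  ring

/-- In the chain rule the second-order term is `φ'' ⟨P_k ∇ρ, ∇ρ⟩`. Constancy of `Hρ + τ` makes `∇ρ`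
an eigenvector of `A`, hence of `P_k` given these `σ_j`, and `|∇ρ|² = ρ² - τ²`. -/
lemma opL_comp_height (h : HasConstantSigma r c f ν) (k : ℕ) (p : M) {φ φ' φ'' : ℝ → ℝ}
    (hφ : ∀ t, HasDerivAt φ (φ' t) t) (hφ' : ∀ t, HasDerivAt φ' (φ'' t) t)
    (hn : 1 ≤ n) (hN : lorentz N N = 0) {H C : ℝ}
    (hC : ∀ q, H * coordFun N f q + coordFun N ν q = C)
    (hσ : ∀ j ≤ k, (principalCurvatures f ν p).esymm j = n.choose j * H ^ j) :
    opL k f ν (fun q => φ (coordFun N f q)) p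
      = φ' (coordFun N f p) * opL k f ν (coordFun N f) p
        + φ'' (coordFun N f p) * ((n - 1).choose k * H ^ k
          * (coordFun N f p ^ 2 - coordFun N ν p ^ 2)) := by
  have hp := mem_chart_target (EuclideanSpace ℝ (Fin n)) p
  have hloc := h.hyp.isLocalHypersurface p
  have h1 := IsLocalHypersurface.localL_comp (X := inChart p f) (η := inChart p ν) hφ hφ'
    hloc.isOpen (IsLocalHypersurface.coordFun_contDiffOn (N := N) hloc.smooth) hp k
  rw [newton_mulVec_of_umbilic hn (hloc.shape_mulVec_grad hp N fun y _ => hC _) hσ k le_rfl,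
    dotProduct_smul, hloc.grad_dot_grad hp hN, smul_eq_mul] at h1
  have e := (chartAt (EuclideanSpace ℝ (Fin n)) p).left_inv (mem_chart_source _ p)
  have e1 : coordFun N (inChart p f) (chartAt (EuclideanSpace ℝ (Fin n)) p p) = coordFun N f p := by
    simp only [coordFun, inChart, Function.comp_apply, e]
  have e2 : coordFun N (inChart p ν) (chartAt (EuclideanSpace ℝ (Fin n)) p p) = coordFun N ν p := by
    simp only [coordFun, inChart, Function.comp_apply, e]
  rw [e1, e2] at h1
  exact h1

end HasConstantSigma

end Manifold

section

/-! ### The height function is constant -/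

/-! ### Curvature inequalities with `H_{m+1} = H^{m+1}`, and the equality case -/

section Curvatures

variable {n m : ℕ} {s : Multiset ℝ} {H : ℝ}

lemma pow_le_normEsymm (hmn : m + 1 ≤ n) (hs : Multiset.card s = n)
    (hpos : ∀ k ≤ m + 1, 0 < normEsymm s k) (hHm : normEsymm s (m + 1) = H ^ (m + 1))
    {k : ℕ} (hk : k ≤ m + 1) : H ^ k ≤ normEsymm s k := by
  have h1 := pow_le_pow_of_newton (h := normEsymm s) (r := m + 1) (normEsymm_zero s) hpos
    (fun k hk => newton_inequality (hk.trans hmn) s hs) (m + 1) hk le_rfl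
  rw [hHm, ← pow_mul, mul_comm, pow_mul] at h1
  exact le_of_pow_le_pow_left₀ (by omega) (hpos k hk).le h1

/-- The inequality `H_{m+2} ≤ H_1 H_{m+1}` bounds the right side below by `(m + 1) σ_{m+1} H_1`, and
`H_1 ≥ H` by Maclaurin. When `n = m + 1` the term `σ_{m+2}` is zero and the first bound is an
equality. -/
lemma le_esymm_one_mul_sub (hmn : m + 1 ≤ n) (hs : Multiset.card s = n)
    (hpos : ∀ k ≤ m + 1, 0 < normEsymm s k) (hHm : normEsymm s (m + 1) = H ^ (m + 1)) :
    (m + 1) * s.esymm (m + 1) * H ≤ s.esymm 1 * s.esymm (m + 1) - (m + 2) * s.esymm (m + 2) := by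
  have h1 : H ≤ normEsymm s 1 := by
    simpa using pow_le_normEsymm hmn hs hpos hHm (k := 1) (by omega)
  have e1 : s.esymm 1 = n * normEsymm s 1 := by
    rw [esymm_eq_choose_mul_normEsymm (by omega), hs, Nat.choose_one_right]
  have e2 : s.esymm (m + 1) = n.choose (m + 1) * normEsymm s (m + 1) := by
    rw [esymm_eq_choose_mul_normEsymm (by omega), hs]
  have hc : (0 : ℝ) < n.choose (m + 1) := by exact_mod_cast Nat.choose_pos hmn
  have hm := hpos (m + 1) le_rfl
  have hmain : n.choose (m + 1) * (m + 1) * (normEsymm s 1 * normEsymm s (m + 1))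
      ≤ s.esymm 1 * s.esymm (m + 1) - (m + 2) * s.esymm (m + 2) := by
    rcases Nat.eq_or_lt_of_le hmn with h | h
    · rw [esymm_eq_zero_of_card_lt (s := s) (k := m + 2) (by omega), e1, e2]
      have : (n : ℝ) = m + 1 := by rw [← h]; push_cast; ring
      rw [this]
      exact le_of_eq (by ring)
    · have h2 := succ_le_one_mul_of_newton (h := normEsymm s) (r := m + 1) (normEsymm_zero s) hpos
        (fun k hk => newton_inequality (by omega) s hs) (m + 1) le_rfl
      have e3 : s.esymm (m + 2) = n.choose (m + 2) * normEsymm s (m + 2) := by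
        rw [esymm_eq_choose_mul_normEsymm (by omega), hs]
      have e4 : (n.choose (m + 2) : ℝ) * (m + 2) = n.choose (m + 1) * (n - (m + 1)) := by
        have := Nat.choose_succ_right_eq n (m + 1)
        have h3 : ((n - (m + 1) : ℕ) : ℝ) = n - (m + 1) := by
          rw [Nat.cast_sub hmn]; push_cast; ring
        rw [← h3]
        exact_mod_cast this
      rw [e1, e2, e3]
      have h4 : 0 ≤ (n.choose (m + 1) : ℝ) * (n - (m + 1)) := by
        have : (m + 1 : ℝ) ≤ n := by exact_mod_cast hmn
        exact mul_nonneg hc.le (by linarith)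
      have h5 := mul_le_mul_of_nonneg_left h2 h4
      rw [← e4] at h5
      have e5 : (n.choose (m + 2) : ℝ) * (m + 2) * (normEsymm s 1 * normEsymm s (m + 1))
          = n.choose (m + 1) * (n - (m + 1)) * (normEsymm s 1 * normEsymm s (m + 1)) := by rw [e4]
      rw [e5] at h5
      linarith
  refine le_trans ?_ hmain
  rw [e2]
  have : 0 ≤ n.choose (m + 1) * (m + 1) * normEsymm s (m + 1) * (normEsymm s 1 - H) :=
    mul_nonneg (by positivity) (by linarith)
  linarith

/-- For `m ≥ 1` this is the equality case of Maclaurin: all curvatures coincide. For `m = 0` the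
hypothesis is vacuous and nothing is umbilic, but only `σ_0 = 1` is claimed, which suffices because
`P_0 = I`. -/
lemma esymm_eq_of_normEsymm_eq (hmn : m + 1 ≤ n) (hs : Multiset.card s = n)
    (hpos : ∀ k ≤ m + 1, 0 < normEsymm s k) (hH : 0 < H) (hHm : normEsymm s (m + 1) = H ^ (m + 1))
    (he : normEsymm s m = H ^ m) : ∀ j ≤ m, s.esymm j = n.choose j * H ^ j := by
  rcases Nat.eq_zero_or_pos m with rfl | hm
  · intro j hj
    obtain rfl : j = 0 := by omega
    simp [esymm_zero']
  · obtain ⟨k, rfl⟩ := Nat.exists_eq_add_of_le' hm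
    have h1 := sq_eq_of_pow_eq (h := normEsymm s) (r := k + 2) (normEsymm_zero s) hpos
      (fun k hk => newton_inequality (hk.trans hmn) s hs) k le_rfl (by
        rw [show k + 2 = k + 1 + 1 from rfl, hHm, he]; ring)
    have h2 := eq_replicate_of_sq_eq (by omega) h1
    rw [hs] at h2
    set x := normEsymm s 1 with hx
    have hx0 : 0 < x := hpos 1 (by omega)
    have h3 : x ^ (k + 1 + 1) = H ^ (k + 1 + 1) := by
      have hc : (n.choose (k + 1 + 1) : ℝ) ≠ 0 := by
        exact_mod_cast (Nat.choose_pos hmn).ne'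
      rw [← hHm, normEsymm, hs, h2, esymm_replicate]
      field_simp
    have h4 : x = H := (pow_left_inj₀ hx0.le hH.le (by omega)).1 h3
    intro j _
    rw [h2, esymm_replicate, h4]

end Curvatures

/-- The component of `N` orthogonal to `η` and `X` is zero or spacelike, and its square is the
difference of the two sides. For `N` in the null cone this is `|Θ| ≤ 1`. -/
lemma sq_normal_le_sq_height {n : ℕ} {X η N : Minkowski n} (hX : lorentz X X = -1)
    (hη : lorentz η η = 1) (hηX : lorentz η X = 0) (hN : lorentz N N = 0) :
    lorentz η N ^ 2 ≤ lorentz X N ^ 2 := by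
  set w := N - lorentz η N • η + lorentz X N • X with hw
  have hwz : ∀ z, lorentz w z = lorentz N z - lorentz η N * lorentz η z
      + lorentz X N * lorentz X z := fun z => by
    rw [hw, lorentz_add_left, lorentz_sub_left, lorentz_smul_left, lorentz_smul_left]
  have h1 : lorentz w X = 0 := by
    rw [hwz, hX, hηX, lorentz_comm N]
    ring
  have h2 : lorentz w w = lorentz X N ^ 2 - lorentz η N ^ 2 := by
    have e1 : lorentz w η = 0 := by
      rw [hwz, hη, lorentz_comm X η, hηX, lorentz_comm N]
      ring
    rw [hwz, lorentz_comm N, lorentz_comm η w, lorentz_comm X w, e1, h1, hwz, hN]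
    ring
  have h3 : 0 ≤ lorentz w w := by
    by_cases h0 : w = 0
    · rw [h0, lorentz_zero_left]
    · exact (lorentz_self_pos hX h1 h0).le
  linarith

variable {n r : ℕ} {M : Type*} [TopologicalSpace M] [ChartedSpace (EuclideanSpace ℝ (Fin n)) M]

lemma opL_const (k : ℕ) (f ν : M → Minkowski n) (C : ℝ) (p : M) :
    opL k f ν (fun _ => C) p = 0 := by
  have h : ∀ (X : EuclideanSpace ℝ (Fin n) → Minkowski n) x,
      hessianMatrix X (fun _ => C) x = 0 := by
    intro X x
    ext i j
    have h1 : pd j (fun _ : EuclideanSpace ℝ (Fin n) => C) = fun _ => 0 :=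
      funext fun y => pd_const C j
    simp [hessianMatrix, h1, pd_const]
  have h2 : inChart p (fun _ : M => C) = fun _ : EuclideanSpace ℝ (Fin n) => C := rfl
  simp [opL, h2, localL, h]

/-- The height of a parabolic hypersurface as in the main theorem is constant. -/
theorem exists_height_eq [IsManifold (𝓡 n) ∞ M] [Nonempty M] (hr : 1 ≤ r) (hrn : r ≤ n)
    {f ν : M → Minkowski n} (hf : IsOrientedHypersurface f ν)
    (hconst : ∃ c : ℝ, ∀ p, meanCurvature r f ν p = c)
    (hadm : IsAdmissible r f ν) (hpar : IsParabolic (r - 1) f ν)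
    {N : Minkowski n} (hN : lorentz N N = 0) {a b : ℝ} (ha : 0 < a)
    (hfa : ∀ p, a ≤ coordFun N f p) (hfb : ∀ p, coordFun N f p ≤ b)
    (hangle : (∀ p, 0 ≤ coordFun N ν p) ∨ (∀ p, coordFun N ν p ≤ 0)) :
    ∃ c, ∀ p, coordFun N f p = c := by
  obtain ⟨m, rfl⟩ := Nat.exists_eq_add_of_le' hr
  rw [Nat.add_sub_cancel] at hpar
  obtain ⟨c, hc⟩ := hconst
  set s := principalCurvatures f ν with hs
  -- Admissibility already exhibits `n` real roots of the characteristic polynomial, so no separate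
  -- diagonalization is needed.
  have hcard : ∀ p, Multiset.card (s p) = n := fun p => by
    obtain ⟨κ, h, -⟩ := hadm p
    rw [hs, ← h]; simp
  have hpos : ∀ p, ∀ k ≤ m + 1, 0 < normEsymm (s p) k := fun p => by
    obtain ⟨κ, h, hκ⟩ := hadm p
    rw [hs, ← h]
    exact normEsymm_pos_of_mem_gardingCone hr hrn hκ
  have hnc : ∀ p, normEsymm (s p) (m + 1) = c := fun p => by
    rw [← hc p, normEsymm, hcard]; rfl
  have hc0 : 0 < c := by
    obtain ⟨p⟩ := ‹Nonempty M›
    rw [← hnc p]; exact hpos p _ le_rfl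
  obtain ⟨H, hH, hHc⟩ : ∃ H : ℝ, 0 < H ∧ H ^ (m + 1) = c :=
    ⟨c ^ (((m + 1 : ℕ) : ℝ)⁻¹), Real.rpow_pos_of_pos hc0 _,
      Real.rpow_inv_natCast_pow hc0.le (by omega)⟩
  have hHm : ∀ p, normEsymm (s p) (m + 1) = H ^ (m + 1) := fun p => by rw [hnc, hHc]
  have hes : ∀ p, ∀ k ≤ n, (s p).esymm k = n.choose k * normEsymm (s p) k := fun p k hk => by
    rw [esymm_eq_choose_mul_normEsymm (by rw [hcard]; exact hk), hcard]
  have hS : HasConstantSigma (m + 1) (n.choose (m + 1) * c) f ν :=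
    ⟨hf, hcard, fun p => by rw [← hnc p]; exact hes p _ hrn⟩
  set ρ := coordFun N f with hρ
  set τ := coordFun N ν with hτ
  set B : ℝ := (m + 1) * n.choose (m + 1) with hB
  have hBpos : 0 < B := by
    have : (0 : ℝ) < n.choose (m + 1) := by exact_mod_cast Nat.choose_pos hrn
    positivity
  have hBm : ((n : ℝ) - m) * n.choose m = B := by
    have := Nat.choose_succ_right_eq n m
    have h3 : ((n - m : ℕ) : ℝ) = n - m := by rw [Nat.cast_sub (by omega)]
    rw [← h3, hB]
    have : (n.choose (m + 1) : ℝ) * (m + 1) = n.choose m * (n - m : ℕ) := by exact_mod_cast this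
    linarith
  have hρpos : ∀ p, 0 < ρ p := fun p => ha.trans_le (hfa p)
  have hτρ : ∀ p, τ p ^ 2 ≤ ρ p ^ 2 := fun p => by
    have := sq_normal_le_sq_height (hf.mem p).1 (hf.normal_unit p) (hf.normal_tangent p) hN
    simpa [hρ, hτ, coordFun] using this
  have hL : ∀ p, opL m f ν ρ p = B * (ρ p * normEsymm (s p) m + τ p * H ^ (m + 1)) := fun p => by
    rw [hρ, hS.opL_height, ← hs, hes p m (by omega), hes p (m + 1) hrn, hHm, ← hρ, ← hτ]
    linear_combination ρ p * normEsymm (s p) m * hBm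
  have hρsmooth : ContMDiff (𝓡 n) 𝓘(ℝ, ℝ) ∞ ρ := contMDiff_coordFun hf.smooth
  have hτsmooth : ContMDiff (𝓡 n) 𝓘(ℝ, ℝ) ∞ τ := contMDiff_coordFun hf.normal_smooth
  have htwo : (2 : WithTop ℕ∞) ≤ ∞ := ENat.LEInfty.out
  have hle : ∀ p, H ^ m ≤ normEsymm (s p) m := fun p =>
    pow_le_normEsymm hrn (hcard p) (hpos p) (hHm p) (by omega)
  have hHmpos : 0 < H ^ m := pow_pos hH m
  have hdirect : (∀ p, 0 ≤ opL m f ν ρ p) → ∃ c, ∀ p, ρ p = c :=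
    hpar ρ (hρsmooth.of_le htwo) ⟨b, by rintro _ ⟨p, rfl⟩; exact hfb p⟩
  rcases hangle with hpos_angle | hneg
  · refine hdirect fun p => ?_
    rw [hL]
    have h1 := hpos_angle p
    have h2 := (hρpos p).le
    have h3 := (hpos p m (by omega)).le
    positivity
  have hτge : ∀ p, -ρ p ≤ τ p := fun p => (abs_le_of_sq_le_sq' (hτρ p) (hρpos p).le).1
  rcases le_or_gt H 1 with hH1 | hH1
  -- Here `ρ H_m + τ H^{m+1} ≥ ρ H^m (1 - H)`, from `H_m ≥ H^m` and `τ ≥ -ρ`.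
  · refine hdirect fun p => ?_
    rw [hL]
    refine mul_nonneg hBpos.le ?_
    have h1 : ρ p * H ^ m ≤ ρ p * normEsymm (s p) m :=
      mul_le_mul_of_nonneg_left (hle p) (hρpos p).le
    have h2 : -ρ p * H ^ (m + 1) ≤ τ p * H ^ (m + 1) :=
      mul_le_mul_of_nonneg_right (hτge p) (by positivity)
    have h3 : 0 ≤ ρ p * H ^ m * (1 - H) :=
      mul_nonneg (mul_nonneg (hρpos p).le hHmpos.le) (by linarith)
    rw [pow_succ] at h2 ⊢
    linarith
  -- The coefficient `H` in `Hρ + τ` is chosen so that the result splits into a Maclaurin deficit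
  -- times `ρ` and a Newton-Maclaurin deficit times `-τ`, both nonnegative.
  have hLu : ∀ p, opL m f ν (fun q => H * ρ q + τ q) p
      = B * H * (ρ p * (normEsymm (s p) m - H ^ m))
        + -τ p * ((s p).esymm 1 * (s p).esymm (m + 1) - (m + 2) * (s p).esymm (m + 2)
          - (m + 1) * (s p).esymm (m + 1) * H) := fun p => by
    rw [hS.opL_height_add_angle, ← hs, ← hρ, ← hτ]
    have e1 := hes p m (by omega)
    have e2 := hes p (m + 1) hrn
    rw [hHm p] at e2
    have e3 : (m + 1) * (s p).esymm (m + 1) = B * H ^ (m + 1) := by rw [e2, hB]; ring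
    rw [e1]
    linear_combination H * ρ p * normEsymm (s p) m * hBm - ρ p * e3
  have hlast : ∀ p, 0 ≤ -τ p * ((s p).esymm 1 * (s p).esymm (m + 1)
      - (m + 2) * (s p).esymm (m + 2) - (m + 1) * (s p).esymm (m + 1) * H) := fun p =>
    mul_nonneg (by linarith [hneg p])
      (by linarith [le_esymm_one_mul_sub hrn (hcard p) (hpos p) (hHm p)])
  have hfirst : ∀ p, 0 ≤ B * H * (ρ p * (normEsymm (s p) m - H ^ m)) := fun p =>
    mul_nonneg (mul_pos hBpos hH).le (mul_nonneg (hρpos p).le (by linarith [hle p]))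
  obtain ⟨C, hC⟩ := hpar (fun q => H * ρ q + τ q)
    (((contMDiff_const.mul hρsmooth).add hτsmooth).of_le htwo)
    ⟨H * b, by
      rintro _ ⟨p, rfl⟩
      have := mul_le_mul_of_nonneg_left (hfb p) hH.le
      have := hneg p
      dsimp only
      linarith⟩
    fun p => by rw [hLu]; exact add_nonneg (hfirst p) (hlast p)
  -- As `u` is constant, both nonnegative summands of `L u` vanish; the first gives equality in
  -- Maclaurin.
  have hmac : ∀ p, normEsymm (s p) m = H ^ m := fun p => by
    have h0 : opL m f ν (fun q => H * ρ q + τ q) p = 0 := by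
      rw [show (fun q => H * ρ q + τ q) = fun _ => C from funext hC]
      exact opL_const m f ν C p
    rw [hLu] at h0
    have h1 : B * H * (ρ p * (normEsymm (s p) m - H ^ m)) = 0 := by
      linarith [hfirst p, hlast p]
    have h2 : normEsymm (s p) m - H ^ m = 0 :=
      (mul_eq_zero.1 ((mul_eq_zero.1 h1).resolve_left (mul_pos hBpos hH).ne')).resolve_left
        (hρpos p).ne'
    linarith
  have hn : (1 : ℝ) ≤ n := by exact_mod_cast hr.trans hrn
  -- Where `ρ + Hτ > 0` one has `τ² ≤ ρ²/H²`, so with this `K`, `K(ρ² - τ²) ≥ nρ²/a ≥ nρ`.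
  -- Positivity of `K` uses `H > 1`.
  set K : ℝ := n / (a * (1 - 1 / H ^ 2)) with hK
  have hHsq : 0 < 1 - 1 / H ^ 2 := by
    rw [sub_pos, div_lt_one (by positivity)]
    nlinarith
  have hKpos : 0 < K := by positivity
  have hφ : ∀ t : ℝ, HasDerivAt (fun t => Real.exp (-K * t)) (-K * Real.exp (-K * t)) t :=
    fun t => by
      have := ((hasDerivAt_id t).const_mul (-K)).exp
      simpa [mul_comm] using this
  have hφ' : ∀ t : ℝ, HasDerivAt (fun t => -K * Real.exp (-K * t))
      (K ^ 2 * Real.exp (-K * t)) t := fun t => by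
    have := (hφ t).const_mul (-K)
    refine this.congr_deriv (by ring)
  have hBn : B = n * (n - 1).choose m := by
    obtain ⟨k, rfl⟩ : ∃ k, n = k + 1 := ⟨n - 1, by omega⟩
    have := Nat.add_one_mul_choose_eq k m
    rw [hB, Nat.add_sub_cancel, mul_comm]
    exact_mod_cast this.symm
  have hexp : ∀ p, 0 ≤ opL m f ν (fun q => Real.exp (-K * ρ q)) p := fun p => by
    rw [hS.opL_comp_height m p hφ hφ' (hr.trans hrn) hN hC
      (esymm_eq_of_normEsymm_eq hrn (hcard p) (hpos p) hH (hHm p) (hmac p)), ← hρ, ← hτ, hL, hmac,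
      hBn]
    have e : -K * Real.exp (-K * ρ p) * (n * (n - 1).choose m * (ρ p * H ^ m + τ p * H ^ (m + 1)))
        + K ^ 2 * Real.exp (-K * ρ p) * ((n - 1).choose m * H ^ m * (ρ p ^ 2 - τ p ^ 2))
        = K * Real.exp (-K * ρ p) * ((n - 1).choose m * H ^ m)
          * (K * (ρ p ^ 2 - τ p ^ 2) - n * (ρ p + H * τ p)) := by ring
    rw [e]
    refine mul_nonneg (by positivity) ?_
    have hQ : 0 ≤ ρ p ^ 2 - τ p ^ 2 := by linarith [hτρ p]
    -- If `ρ + Hτ ≤ 0` the first-order term has the good sign; otherwise the gradient term dominates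
    -- it by the choice of `K`.
    rcases le_or_gt (ρ p + H * τ p) 0 with h | h
    · have h1 : (n : ℝ) * (ρ p + H * τ p) ≤ 0 := mul_nonpos_of_nonneg_of_nonpos (by linarith) h
      have h2 : 0 ≤ K * (ρ p ^ 2 - τ p ^ 2) := mul_nonneg hKpos.le hQ
      linarith
    · have h1 : -τ p ≤ ρ p / H := by
        rw [le_div_iff₀ hH]; linarith
      have h2 : τ p ^ 2 ≤ ρ p ^ 2 / H ^ 2 := by
        rw [← div_pow, ← neg_sq (τ p)]
        exact pow_le_pow_left₀ (by linarith [hneg p]) h1 2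
      have h3 : ρ p ^ 2 * (1 - 1 / H ^ 2) ≤ ρ p ^ 2 - τ p ^ 2 := by
        rw [mul_sub, mul_one, mul_one_div]; linarith
      have h4 : n * ρ p ≤ K * (ρ p ^ 2 - τ p ^ 2) :=
        calc (n : ℝ) * ρ p ≤ n * (ρ p * (ρ p / a)) := by
              have : 1 ≤ ρ p / a := by rw [one_le_div ha]; exact hfa p
              have := mul_le_mul_of_nonneg_left this (hρpos p).le
              rw [mul_one] at this
              gcongr
          _ = K * (ρ p ^ 2 * (1 - 1 / H ^ 2)) := by
              rw [hK]
              have := hHsq.ne'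
              generalize 1 - 1 / H ^ 2 = d at this
              field_simp
          _ ≤ _ := mul_le_mul_of_nonneg_left h3 hKpos.le
      have h5 : (n : ℝ) * (ρ p + H * τ p) ≤ n * ρ p := by
        have : H * τ p ≤ 0 := mul_nonpos_of_nonneg_of_nonpos hH.le (hneg p)
        gcongr; linarith
      linarith
  obtain ⟨D, hD⟩ := hpar (fun q => Real.exp (-K * ρ q))
    (((show ContDiff ℝ ∞ fun t : ℝ => Real.exp (-K * t) by fun_prop).contMDiff.comp
      hρsmooth).of_le htwo)
    ⟨1, by
      rintro _ ⟨p, rfl⟩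
      refine Real.exp_le_one_iff.2 ?_
      have := mul_pos hKpos (hρpos p)
      linarith⟩ hexp
  refine ⟨Real.log D / -K, fun p => ?_⟩
  rw [← hD p, Real.log_exp]
  field_simp

end

/-! ### Properly immersed hypersurfaces of a horosphere -/

/-- A proper local homeomorphism from a connected Hausdorff space to a simply connected space is
bijective. -/
theorem bijective_of_isProperMap_of_isLocalHomeomorph {M W : Type*} [TopologicalSpace M]
    [T2Space M] [ConnectedSpace M] [TopologicalSpace W] [T1Space W] [SimplyConnectedSpace W]
    [LocallyPathConnectedSpace W] {F : M → W} (hF : IsProperMap F) (hl : IsLocalHomeomorph F) :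
    Function.Bijective F := by
  -- Fibres of `F` are compact and discrete, hence finite; a closed local homeomorphism with finite
  -- fibres is a covering.
  have hcov : IsCoveringMap F := by
    rw [isCoveringMap_iff_isCoveringMapOn_univ]
    refine hF.isClosedMap.isCoveringMapOn_of_isLocalHomeomorphOn (fun x _ => ?_)
      hl.isLocalHomeomorphOn
    exact (hF.isCompact_preimage isCompact_singleton).finite
      (IsDiscrete.of_openPartialHomeomorph F subset_rfl fun e _ => by
        obtain ⟨φ, h1, h2⟩ := hl e
        exact ⟨φ, h1, h2.symm⟩)
  obtain ⟨p⟩ : Nonempty M := inferInstance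
  -- Simple connectedness lifts the identity to a section through `p`. Then `s ∘ F` and `id` are
  -- lifts of `F` agreeing at `p`, so they coincide on the connected `M`.
  obtain ⟨s, ⟨hs, hFs⟩, -⟩ := hcov.existsUnique_continuousMap_lifts (ContinuousMap.id W) (F p) p rfl
  have hsF : s ∘ F = id := by
    refine hcov.eq_of_comp_eq (s.continuous.comp hF.continuous) continuous_id ?_ p hs
    rw [← Function.comp_assoc, hFs]
    rfl
  exact ⟨Function.LeftInverse.injective (congrFun hsF),
    Function.RightInverse.surjective (congrFun hFs)⟩

/-! ### Horospheres as graphs over `ℝ^n` -/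

section Horosphere

variable {n : ℕ}

/-- The spatial part of a vector of Minkowski space. -/
def spatial (n : ℕ) : Minkowski n →L[ℝ] EuclideanSpace ℝ (Fin (n + 1)) :=
  LinearMap.toContinuousLinearMap
    { toFun := fun x => WithLp.toLp 2 fun i => x i.succ
      map_add' := fun _ _ => rfl
      map_smul' := fun _ _ => rfl }

lemma spatial_apply (x : Minkowski n) (i : Fin (n + 1)) : spatial n x i = x i.succ := rfl

/-- The vector with given time coordinate and spatial part. -/
def ofTimeSpatial (t : ℝ) (v : EuclideanSpace ℝ (Fin (n + 1))) : Minkowski n :=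
  WithLp.toLp 2 (Fin.cons t v)

lemma ofTimeSpatial_self (x : Minkowski n) : ofTimeSpatial (x 0) (spatial n x) = x := by
  ext i
  refine Fin.cases ?_ (fun j => ?_) i
  · rfl
  · simp [spatial_apply, ofTimeSpatial]

lemma lorentz_eq_inner (x y : Minkowski n) :
    lorentz x y = -(x 0 * y 0) + inner ℝ (spatial n x) (spatial n y) := by
  rw [lorentz, PiLp.inner_apply]
  congr 1
  exact Finset.sum_congr rfl fun i _ => by simp [spatial_apply, mul_comm]

lemma continuous_ofTimeSpatial {W : Type*} [TopologicalSpace W] {t : W → ℝ}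
    {v : W → EuclideanSpace ℝ (Fin (n + 1))} (ht : Continuous t) (hv : Continuous v) :
    Continuous fun y => (ofTimeSpatial (t y) (v y) : Minkowski n) := by
  refine (PiLp.continuous_toLp 2 _).comp (continuous_pi fun i => ?_)
  refine Fin.cases ?_ (fun j => ?_) i
  · exact ht
  · simp only [Fin.cons_succ]
    fun_prop

/-- The unit vector of `ℝ^{n+1}` in the direction of a null vector. -/
def nullDirection (N : Minkowski n) : EuclideanSpace ℝ (Fin (n + 1)) := (N 0)⁻¹ • spatial n N

/-- The model `ℝ^n` of a horosphere. -/
abbrev horosphereModel (N : Minkowski n) : Submodule ℝ (EuclideanSpace ℝ (Fin (n + 1))) :=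
  (Submodule.span ℝ {nullDirection N})ᗮ

/-- The projection of Minkowski space to the model of the horospheres. -/
def horosphereProj (N : Minkowski n) : Minkowski n →L[ℝ] horosphereModel N :=
  (horosphereModel N).orthogonalProjectionOnto.comp (spatial n)

/-- The parametrization of a horosphere by `ℝ^n`. -/
def horosphereParam (N : Minkowski n) (c : ℝ) (y : horosphereModel N) : Minkowski n :=
  ofTimeSpatial (((1 + ‖y‖ ^ 2) / (c / N 0) + c / N 0) / 2)
    ((((1 + ‖y‖ ^ 2) / (c / N 0) - c / N 0) / 2) • nullDirection N + y)

variable {N : Minkowski n} {c : ℝ}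

lemma norm_nullDirection (hN : N ∈ nullCone n) : ‖nullDirection N‖ = 1 := by
  obtain ⟨h1, h2⟩ := hN
  rw [lorentz_eq_inner, real_inner_self_eq_norm_sq] at h1
  have h3 : ‖spatial n N‖ = N 0 := by
    rw [← abs_of_pos h2, ← abs_of_nonneg (norm_nonneg (spatial n N)), ← sq_eq_sq_iff_abs_eq_abs]
    linarith
  rw [nullDirection, norm_smul, h3, norm_inv, Real.norm_of_nonneg h2.le, inv_mul_cancel₀ h2.ne']

lemma spatial_eq_smul_nullDirection (hN : N ∈ nullCone n) :
    spatial n N = N 0 • nullDirection N := by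
  rw [nullDirection, smul_smul, mul_inv_cancel₀ hN.2.ne', one_smul]

lemma spatial_eq_add (hN : N ∈ nullCone n) (x : Minkowski n) :
    spatial n x = inner ℝ (nullDirection N) (spatial n x) • nullDirection N
      + (horosphereProj N x : EuclideanSpace ℝ (Fin (n + 1))) := by
  have h := Submodule.starProjection_add_starProjection_orthogonal
    (K := Submodule.span ℝ {nullDirection N}) (spatial n x)
  rw [Submodule.starProjection_unit_singleton ℝ (norm_nullDirection hN)] at h
  exact h.symm

lemma inner_nullDirection_model (N : Minkowski n) (y : horosphereModel N) :
    inner ℝ (nullDirection N) (y : EuclideanSpace ℝ (Fin (n + 1))) = 0 :=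
  Submodule.mem_orthogonal_singleton_iff_inner_right.1 y.2

lemma lorentz_null (hN : N ∈ nullCone n) (x : Minkowski n) :
    lorentz x N = N 0 * (inner ℝ (nullDirection N) (spatial n x) - x 0) := by
  rw [lorentz_eq_inner, spatial_eq_smul_nullDirection hN, inner_smul_right, real_inner_comm]
  ring

lemma norm_sq_smul_add (hN : N ∈ nullCone n) (t : ℝ) (y : horosphereModel N) :
    ‖t • nullDirection N + (y : EuclideanSpace ℝ (Fin (n + 1)))‖ ^ 2 = t ^ 2 + ‖y‖ ^ 2 := by
  rw [← real_inner_self_eq_norm_sq, inner_add_left, inner_add_right, inner_add_right,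
    inner_smul_left, inner_smul_left, inner_smul_right, inner_smul_right,
    real_inner_comm (nullDirection N) (y : EuclideanSpace ℝ (Fin (n + 1))),
    inner_nullDirection_model, real_inner_self_eq_norm_sq, real_inner_self_eq_norm_sq,
    norm_nullDirection hN]
  simp
  ring

lemma lorentz_self_eq (hN : N ∈ nullCone n) (x : Minkowski n) :
    lorentz x x = -x 0 ^ 2 + inner ℝ (nullDirection N) (spatial n x) ^ 2
      + ‖horosphereProj N x‖ ^ 2 := by
  have h := norm_sq_smul_add hN (inner ℝ (nullDirection N) (spatial n x)) (horosphereProj N x)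
  rw [← spatial_eq_add hN] at h
  rw [lorentz_eq_inner, real_inner_self_eq_norm_sq, h]
  ring

/-- Let `s` be the component of `x` along the null direction and `y` its projection. The horosphere
equation fixes `x₀ - s = c / N₀`, and the hyperboloid equation `(x₀ - s)(x₀ + s) = 1 + ‖y‖²` then
fixes `x₀ + s`. -/
lemma horosphereParam_proj (hN : N ∈ nullCone n) (hc : 0 < c) {x : Minkowski n}
    (hx : x ∈ horosphere N c) : horosphereParam N c (horosphereProj N x) = x := by
  obtain ⟨⟨h1, -⟩, h2⟩ := hx
  rw [lorentz_null hN] at h2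
  rw [lorentz_self_eq hN] at h1
  set s := inner ℝ (nullDirection N) (spatial n x) with hs
  have hN0 := hN.2
  have hd : c / N 0 = x 0 - s := by
    rw [div_eq_iff hN0.ne']; linarith
  have hd0 : x 0 - s ≠ 0 := by rw [← hd]; positivity
  have h3 : (1 + ‖horosphereProj N x‖ ^ 2) / (x 0 - s) = x 0 + s := by
    rw [div_eq_iff hd0]; linarith
  rw [horosphereParam, hd, h3]
  conv_rhs => rw [← ofTimeSpatial_self x, spatial_eq_add hN x, ← hs]
  congr 1
  · ring
  · congr 2; ring

/-- A vector orthogonal to `N` with zero projection has `⟨v, v⟩ = 0`, whereas nonzero vectors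
orthogonal to `X` are spacelike. -/
lemma horosphereProj_tangent (hN : N ∈ nullCone n) {X v : Minkowski n}
    (hX : lorentz X X = -1) (hv : lorentz v X = 0) (hvN : lorentz v N = 0)
    (h : horosphereProj N v = 0) : v = 0 := by
  by_contra hv0
  have h1 := lorentz_self_pos hX hv hv0
  rw [lorentz_null hN] at hvN
  have h2 := (mul_eq_zero.1 hvN).resolve_left hN.2.ne'
  rw [lorentz_self_eq hN, h, norm_zero, sub_eq_zero.1 h2] at h1
  simp at h1

lemma finrank_horosphereModel (hN : N ∈ nullCone n) :
    Module.finrank ℝ (horosphereModel N) = n := by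
  have : Fact (Module.finrank ℝ (EuclideanSpace ℝ (Fin (n + 1))) = n + 1) := ⟨by simp⟩
  refine Submodule.finrank_orthogonal_span_singleton fun h => ?_
  have := norm_nullDirection hN
  rw [h, norm_zero] at this
  exact zero_ne_one this

lemma continuous_horosphereParam (N : Minkowski n) (c : ℝ) : Continuous (horosphereParam N c) := by
  refine continuous_ofTimeSpatial ?_ ?_ <;> fun_prop

variable {M : Type*} [TopologicalSpace M] [ChartedSpace (EuclideanSpace ℝ (Fin n)) M]
  [IsManifold (𝓡 n) ∞ M] {f ν : M → Minkowski n}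

/-- Inverse function theorem: the differential of `f` lands in vectors tangent to the horosphere, on
which the projection is injective, and the dimensions agree. -/
lemma isLocalHomeomorph_horosphereProj_comp (hN : N ∈ nullCone n)
    (hf : IsOrientedHypersurface f ν) (hfN : ∀ p, lorentz (f p) N = -c) :
    IsLocalHomeomorph (horosphereProj N ∘ f) := by
  refine IsLocalHomeomorph.mk _ fun p => ?_
  set e := chartAt (EuclideanSpace ℝ (Fin n)) p
  have hloc := hf.isLocalHypersurface p
  have hp : e p ∈ e.target := mem_chart_target _ p
  have hG : ContDiffAt ℝ ∞ (horosphereProj N ∘ inChart p f) (e p) :=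
    (horosphereProj N).contDiff.contDiffAt.comp _ (hloc.smooth.contDiffAt (hloc.isOpen.mem_nhds hp))
  have hstrict := hG.hasStrictFDerivAt (by simp)
  have hfd : fderiv ℝ (horosphereProj N ∘ inChart p f) (e p)
      = (horosphereProj N).comp (fderiv ℝ (inChart p f) (e p)) := by
    rw [fderiv_comp _ (horosphereProj N).differentiableAt (hloc.dX hp),
      ContinuousLinearMap.fderiv]
  have horth : ∀ (Y : Minkowski n) (d : ℝ) (v : EuclideanSpace ℝ (Fin n)),
      (∀ y ∈ e.target, lorentz (inChart p f y) Y = d) →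
        lorentz (fderiv ℝ (inChart p f) (e p) v) Y = 0 := by
    intro Y d v h
    have h1 : (fun y => lorentzCLM n Y (inChart p f y)) =ᶠ[nhds (e p)] fun _ => d := by
      filter_upwards [hloc.isOpen.mem_nhds hp] with y hy
      rw [lorentzCLM_apply, lorentz_comm, h y hy]
    have h2 := h1.fderiv_eq (𝕜 := ℝ)
    change fderiv ℝ (lorentzCLM n Y ∘ inChart p f) (e p) = _ at h2
    rw [fderiv_comp _ (lorentzCLM n Y).differentiableAt (hloc.dX hp),
      ContinuousLinearMap.fderiv] at h2
    have h3 := congrArg (fun L => L v) h2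
    rw [lorentz_comm, ← lorentzCLM_apply]
    simpa using h3
  have htan : ∀ v, lorentz (fderiv ℝ (inChart p f) (e p) v) (inChart p f (e p)) = 0 := by
    intro v
    have hB := (lorentzCLM n).hasFDerivAt_of_bilinear (hloc.dX hp).hasFDerivAt
      (hloc.dX hp).hasFDerivAt
    have h1 : (fun y => lorentzCLM n (inChart p f y) (inChart p f y))
        =ᶠ[nhds (e p)] fun _ => -1 := by
      filter_upwards [hloc.isOpen.mem_nhds hp] with y hy
      exact (hloc.frame y hy).pos
    have h2 := congrArg (fun L => L v) (hB.fderiv.symm.trans (h1.fderiv_eq (𝕜 := ℝ)))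
    simp [lorentzCLM_apply] at h2
    rw [lorentz_comm (inChart p f (e p))] at h2
    linarith
  have hinj : Function.Injective (fderiv ℝ (horosphereProj N ∘ inChart p f) (e p)) := by
    rw [injective_iff_map_eq_zero]
    intro v hv
    rw [hfd, ContinuousLinearMap.comp_apply] at hv
    have h1 := horosphereProj_tangent hN (hloc.frame _ hp).pos (htan v)
      (horth N (-c) v fun y _ => hfN _) hv
    obtain ⟨L, hL, hLv⟩ := fderiv_inChart hf.smooth p hp
    refine hL ?_
    rw [map_zero]
    exact hf.immersion _ (((hLv v).symm.trans h1).trans (map_zero (mfderiv (𝓡 n)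
      𝓘(ℝ, Minkowski n) f (e.symm (e p)))).symm)
  let A : EuclideanSpace ℝ (Fin n) ≃L[ℝ] horosphereModel N :=
    (LinearEquiv.ofInjectiveOfFinrankEq
      (fderiv ℝ (horosphereProj N ∘ inChart p f) (e p)).toLinearMap hinj
      (by rw [finrank_horosphereModel hN]; simp)).toContinuousLinearEquiv
  have hA : HasStrictFDerivAt (horosphereProj N ∘ inChart p f)
      (A : EuclideanSpace ℝ (Fin n) →L[ℝ] horosphereModel N) (e p) := by
    have hAe : (A : EuclideanSpace ℝ (Fin n) →L[ℝ] horosphereModel N)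
        = fderiv ℝ (horosphereProj N ∘ inChart p f) (e p) := by
      ext1 v; rfl
    rw [hAe]
    exact hstrict
  refine ⟨e.trans (hA.toOpenPartialHomeomorph _), ?_, ?_⟩
  · rw [OpenPartialHomeomorph.trans_source]
    exact ⟨mem_chart_source _ p, hA.mem_toOpenPartialHomeomorph_source⟩
  · intro q hq
    rw [OpenPartialHomeomorph.trans_source] at hq
    rw [OpenPartialHomeomorph.coe_trans, hA.toOpenPartialHomeomorph_coe]
    simp only [Function.comp_apply, inChart]
    rw [e.left_inv hq.1]

/-- A connected hypersurface properly immersed in a horosphere is embedded onto it. -/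
theorem injective_and_range_eq_horosphere [T2Space M] [ConnectedSpace M] (hN : N ∈ nullCone n)
    (hc : 0 < c) (hf : IsOrientedHypersurface f ν) (hproper : IsProperMap f)
    (hfN : ∀ p, lorentz (f p) N = -c) :
    Function.Injective f ∧ Set.range f = horosphere N c := by
  have hl := isLocalHomeomorph_horosphereProj_comp hN hf hfN
  have hmem : ∀ p, f p ∈ horosphere N c := fun p => ⟨hf.mem p, hfN p⟩
  have hparam : horosphereParam N c ∘ (horosphereProj N ∘ f) = f :=
    funext fun p => horosphereParam_proj hN hc (hmem p)
  -- Properness descends from `f`, which is the continuous parametrization composed with this map.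
  have hp : IsProperMap (horosphereProj N ∘ f) :=
    isProperMap_of_comp_of_t2 hl.continuous (continuous_horosphereParam N c)
      (by rw [hparam]; exact hproper)
  obtain ⟨hinj, hsurj⟩ := bijective_of_isProperMap_of_isLocalHomeomorph hp hl
  refine ⟨hinj.of_comp, Set.Subset.antisymm (by rintro _ ⟨p, rfl⟩; exact hmem p) fun x hx => ?_⟩
  obtain ⟨p, h⟩ := hsurj (horosphereProj N x)
  refine ⟨p, ?_⟩
  rw [← horosphereParam_proj hN hc hx, ← h]
  exact (congrFun hparam p).symm

end Horosphere

/-! ### The angle function and the main theorem -/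

section

variable {n : ℕ} {M : Type*} [TopologicalSpace M] [ChartedSpace (EuclideanSpace ℝ (Fin n)) M]
  {f ν : M → Minkowski n}

/-- Since the height is positive on a slab, the sign of `Θ` is that of `-⟨ν, N⟩`. -/
lemma angle_eq_div (hf : IsOrientedHypersurface f ν) (N : Minkowski n) (p : M) :
    angle N f ν p = coordFun N ν p / coordFun N f p := by
  rw [angle, verticalField, lorentz_add_right, lorentz_smul_right, hf.normal_tangent, coordFun,
    coordFun, neg_div_neg_eq]
  ring

end

end HyperbolicHypersurface

end
open HyperbolicHypersurface in
theorem theorem4p3 {n r : ℕ} (hr : 1 ≤ r) (hrn : r ≤ n)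
    {M : Type*} [TopologicalSpace M] [T2Space M] [SecondCountableTopology M] [ConnectedSpace M]
    [ChartedSpace (EuclideanSpace ℝ (Fin n)) M] [IsManifold (𝓡 n) ∞ M]
    (f ν : M → Minkowski n) (hf : IsOrientedHypersurface f ν)
    (hcomplete : IsCompleteHypersurface f) (hproper : IsProperMap f)
    (hconst : ∃ c : ℝ, ∀ p, meanCurvature r f ν p = c)
    (hadm : IsAdmissible r f ν) (hpar : IsParabolic (r - 1) f ν)
    (N : Minkowski n) (hN : N ∈ nullCone n) (a b : ℝ) (ha : 0 < a) (hab : a < b)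
    (hslab : ∀ p, f p ∈ slab N a b)
    (hangle : (∀ p, 0 ≤ angle N f ν p) ∨ (∀ p, angle N f ν p ≤ 0)) :
    Function.Injective f ∧ IsHorosphere (Set.range f) := by
  have hpos : ∀ p, 0 < coordFun N f p := fun p => ha.trans_le (hslab p).2.1
  obtain ⟨c, hc⟩ := exists_height_eq hr hrn hf hconst hadm hpar hN.1 ha (fun p => (hslab p).2.1)
    (fun p => (hslab p).2.2) (by
      simp only [angle_eq_div hf] at hangle
      refine hangle.imp (fun h p => ?_) (fun h p => ?_)
      · simpa [div_mul_cancel₀ _ (hpos p).ne'] using mul_nonneg (h p) (hpos p).le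
      · simpa [div_mul_cancel₀ _ (hpos p).ne'] using
          mul_nonpos_of_nonpos_of_nonneg (h p) (hpos p).le)
  obtain ⟨p⟩ : Nonempty M := inferInstance
  have hc0 : 0 < c := hc p ▸ hpos p
  obtain ⟨hinj, hrange⟩ := injective_and_range_eq_horosphere hN hc0 hf hproper
    fun p => neg_eq_iff_eq_neg.1 (hc p)
  exact ⟨hinj, N, hN, c, hc0, hrange⟩
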